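/- **Notation.** For a tree $T$ and a vertex $w$, $T(w)$ is the forest obtained by deleting $w$, and for a neighbour $v$ of $w$, $T_v(w)$ is the component of $T(w)$ containing $v$. $N(w)$ is the set of neighbours of $w$. $S^-(T)$ is the set of real skew-symmetric matrices $A=[a_{ij}]$, indexed by the vertices of $T$, such that for $i\ne j$ one has $a_{ij}\neq 0$ iff $ij$ is an edge of $T$. $A(w)$ and $A_v(w)$ are the principal submatrices of $A$ corresponding to $T(w)$ and $T_v(w)$. Eigenvalues are counted with multiplicity. For $\mathcal A,\mathcal B\subset \mathrm i\mathbb R$ of sizes $n$ and $n-1$, $\mathcal B$ *strictly interlaces* $\mathcal A$ if $\mathcal A=\{\mathrm i\lambda_1,\dots,\mathrm i\lambda_n\}$ and $\mathcal B=\{\mathrm i\mu_1,\dots,\mathrm i\mu_{n-1}\}$ with $\lambda_1<\mu_1<\lambda_2<\cdots<\mu_{n-1}<\lambda_n$. $T$, a tree on $n$ vertices, is *NEB at $w$* (nearly even branching) if $n=1$, or if $n\ge 2$ and (i) $T(w)$ has exactly one component of odd order if $n$ is even, and none if $n$ is odd, and (ii) $T_v(w)$ is NEB at $v$ for each $v\in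 N(w)$. A real skew-symmetric matrix $A$ whose graph is a tree $T$ has the *Duarte property with respect to $w$* if $T$ has one vertex, or if the eigenvalues of $A(w)$ strictly interlace those of $A$ and $A_v(w)$ has the Duarte property with respect to $v$ for each $v\in N(w)$. **Construction.** Given a tree $T$ on $n$ vertices, a vertex $v$ and monic polynomials $f,g\in\mathbb C[x]$ of degrees $n$ and $n-1$, matrices $A$ are constructed recursively: * If $n=1$, $f=x$, $g=1$: $A=[0]$. * If $n=2$, $f=(x-\mathrm i\lambda_1)(x+\mathrm i\lambda_1)$ with $\lambda_1<0$, and $g=x$: $A=\begin{bmatrix}0&\lambda_1\\-\lambda_1&0\end{bmatrix}$, for either ordering of the two vertices. * If $n\ge 3$: choose a factorization $g=\prod_{j\in N(v)}g_j$ where $g_j$ is monic with $\deg g_j=|T_j(v)|$ and the roots of $g_j$ are $0$ or come in complex conjugate purely imaginary pairs, and write $$\frac{f(x)}{g(x)}=x+\sum_{j\in N(v)}y_j\frac{h_j(x)}{g_j(x)}$$ with $y_j$ real and $h_j$ monic, $\deg h_j<\deg g_j$. For each $j\in N(v)$ let $B_j$ be a matrix constructed for the tree $T_j(v)$, its vertex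 $j$ and the polynomials $g_j,h_j$. Put $a_{vj}=-a_{jv}=\sqrt{y_j}$ and $A_j(v)=B_j$ for $j\in N(v)$, and let all other entries of $A$ be $0$. **Corollary.** Let $T$ be a tree on $n$ vertices that is NEB at a vertex $v$. (a) Suppose $n\ge 2$ and let $\lambda_1<\mu_1<\lambda_2<\cdots<\mu_{n-1}<\lambda_n$ be real numbers with $\lambda_j=-\lambda_{n+1-j}$ for $1\le j\le n$ and $\mu_k=-\mu_{n-k}$ for $1\le k\le n-1$. Put $f=\prod_{j=1}^n(x-\mathrm i\lambda_j)$ and $g=\prod_{k=1}^{n-1}(x-\mathrm i\mu_k)$. Then the construction can be carried out for $T,v,f,g$, and every matrix $A$ it produces lies in $S^-(T)$, has eigenvalues $\mathrm i\lambda_1,\dots,\mathrm i\lambda_n$, is such that $A(v)$ has eigenvalues $\mathrm i\mu_1,\dots,\mathrm i\mu_{n-1}$, and has the Duarte property with respect to $v$. (b) Consequently, there is a matrix $A\in S^-(T)$ that has the Duarte property with respect to $v$. -/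

import Mathlib

open Polynomial

universe u

/-- `T_v(w)`: the vertex set of the connected component containing `v` of the graph `T(w)`
obtained from `T` by deleting the vertex `w`. -/
def treeBranch {V : Type u} (T : SimpleGraph V) (w v : V) : Set V :=
  {x | ∃ (hv : v ∈ ({w}ᶜ : Set V)) (hx : x ∈ ({w}ᶜ : Set V)),
    (T.induce ({w}ᶜ : Set V)).Reachable ⟨v, hv⟩ ⟨x, hx⟩}

theorem mem_treeBranch_self {V : Type u} (T : SimpleGraph V) {w v : V} (h : T.Adj w v) :
    v ∈ treeBranch T w v :=
  ⟨h.ne', h.ne', SimpleGraph.Reachable.refl _⟩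

/-- The tree `T` has the nearly even branching property at the vertex `w`. -/
inductive IsNEB : ∀ {V : Type u}, SimpleGraph V → V → Prop
  | single {V : Type u} (T : SimpleGraph V) (w : V) (hT : T.IsTree) (hn : Nat.card V = 1) :
      IsNEB T w
  | step {V : Type u} (T : SimpleGraph V) (w : V) (hT : T.IsTree) (hn : 2 ≤ Nat.card V)
      (heven : Even (Nat.card V) → (T.induce ({w}ᶜ : Set V)).oddComponents.ncard = 1)
      (hodd : Odd (Nat.card V) → (T.induce ({w}ᶜ : Set V)).oddComponents = ∅)
      (hbranch : ∀ (v : V) (h : T.Adj w v),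
        IsNEB (T.induce (treeBranch T w v)) ⟨v, mem_treeBranch_self T h⟩) :
      IsNEB T w

/-- The graph `G(A)` of a (symmetric or skew-symmetric) matrix `A`. -/
def matrixGraph {V : Type u} (A : Matrix V V ℝ) : SimpleGraph V :=
  SimpleGraph.fromRel (fun i j => A i j ≠ 0)

/-- `S⁻(G)`: the real skew-symmetric matrices whose graph is `G`. -/
def skewMatrices {V : Type u} (G : SimpleGraph V) : Set (Matrix V V ℝ) :=
  {A | A.transpose = -A ∧ matrixGraph A = G}

/-- The principal submatrix of `A` with rows and columns in `s`. -/
def principalSub {V : Type u} (A : Matrix V V ℝ) (s : Set V) : Matrix s s ℝ :=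
  A.submatrix Subtype.val Subtype.val

open Classical in
/-- The complex eigenvalues of a real matrix, with algebraic multiplicity. -/
noncomputable def matrixEigs {V : Type u} [Fintype V] (A : Matrix V V ℝ) : Multiset ℂ :=
  (A.map Complex.ofReal).charpoly.roots

/-- `M` strictly interlaces `L`, both lying on the imaginary axis:
`L = {i l₁, …, i lₙ}`, `M = {i m₁, …, i mₙ₋₁}` and `l₁ < m₁ < l₂ < ⋯ < mₙ₋₁ < lₙ`. -/
def StrictlyInterlaces (M L : Multiset ℂ) : Prop :=
  ∃ (k : ℕ) (l : Fin (k + 1) → ℝ) (m : Fin k → ℝ),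
    L = Finset.univ.val.map (fun j => Complex.I * (l j : ℂ)) ∧
    M = Finset.univ.val.map (fun j => Complex.I * (m j : ℂ)) ∧
    ∀ j : Fin k, l j.castSucc < m j ∧ m j < l j.succ

open Classical in
/-- `A`, a matrix whose graph is a tree, has the Duarte property with respect to the vertex `w`
(for matrices whose eigenvalues are purely imaginary, such as real skew-symmetric ones). -/
inductive HasDuarte : ∀ {V : Type u} [Fintype V], Matrix V V ℝ → V → Prop
  | single {V : Type u} [Fintype V] (A : Matrix V V ℝ) (w : V)
      (hT : (matrixGraph A).IsTree) (hn : Fintype.card V = 1) : HasDuarte A w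
  | step {V : Type u} [Fintype V] (A : Matrix V V ℝ) (w : V)
      (hT : (matrixGraph A).IsTree) (hn : 1 < Fintype.card V)
      (hinter : StrictlyInterlaces (matrixEigs (principalSub A ({w}ᶜ : Set V))) (matrixEigs A))
      (hbranch : ∀ (v : V) (h : (matrixGraph A).Adj w v),
        HasDuarte (principalSub A (treeBranch (matrixGraph A) w v))
          ⟨v, mem_treeBranch_self (matrixGraph A) h⟩) :
      HasDuarte A w

open Classical in
/-- `IsConstructed T v f g A`: the matrix `A` is an output of the following recursive construction
for the tree `T` rooted at `v` and the polynomials `f`, `g`, the prospective characteristic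
polynomials of `A` and `A(v)`.
* One vertex, `f = x`, `g = 1`: `A = [0]`.
* Two vertices `p`, `q` (either of them may be `v`), `f = (x - iλ)(x + iλ)` with `λ < 0`, `g = x`:
  `A` has rows `(0, λ)`, `(-λ, 0)`.
* At least three vertices: factor `g` as the product over the neighbours `j` of `v` of monic
  polynomials `g_j` of degree `|T_j(v)|` whose roots are `0` or conjugate pairs of purely imaginary
  numbers; write `f / g = x + ∑ y_j h_j / g_j` (here with denominators cleared) with `h_j` monic and
  `deg h_j < deg g_j`; construct `B_j` for `T_j(v)` rooted at `j`, `g_j` and `h_j`;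
  put `a_{vj} = -a_{jv} = √y_j`, `A_j(v) = B_j`, and `0` in all other entries. -/
inductive IsConstructed : ∀ {V : Type u} [Fintype V],
    SimpleGraph V → V → ℂ[X] → ℂ[X] → Matrix V V ℝ → Prop
  | one {V : Type u} [Fintype V] (T : SimpleGraph V) (v : V) (f g : ℂ[X]) (A : Matrix V V ℝ)
      (hn : Fintype.card V = 1) (hf : f = X) (hg : g = 1) (hA : A = 0) :
      IsConstructed T v f g A
  | two {V : Type u} [Fintype V] (T : SimpleGraph V) (v : V) (f g : ℂ[X]) (A : Matrix V V ℝ)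
      (hn : Fintype.card V = 2) (l : ℝ) (hl : l < 0)
      (hf : f = (X - C (Complex.I * (l : ℂ))) * (X + C (Complex.I * (l : ℂ)))) (hg : g = X)
      (p q : V) (hpq : p ≠ q)
      (hApq : A p q = l) (hAqp : A q p = -l) (hApp : A p p = 0) (hAqq : A q q = 0) :
      IsConstructed T v f g A
  | step {V : Type u} [Fintype V] (T : SimpleGraph V) (v : V) (f g : ℂ[X]) (A : Matrix V V ℝ)
      (hn : 3 ≤ Fintype.card V) (gs hs : V → ℂ[X]) (y : V → ℝ)
      (hgs_monic : ∀ j, T.Adj v j → (gs j).Monic)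
      (hgs_deg : ∀ j, T.Adj v j → (gs j).natDegree = Fintype.card (treeBranch T v j))
      (hgs_roots : ∀ j, T.Adj v j →
        ∀ z ∈ (gs j).roots, z.re = 0 ∧ (starRingEnd ℂ) z ∈ (gs j).roots)
      (hg : g = ∏ j ∈ T.neighborFinset v, gs j)
      (hhs_monic : ∀ j, T.Adj v j → (hs j).Monic)
      (hhs_deg : ∀ j, T.Adj v j → (hs j).degree < (gs j).degree)
      (hf : f = X * g + ∑ j ∈ T.neighborFinset v,
        C (y j : ℂ) * hs j * ∏ k ∈ (T.neighborFinset v).erase j, gs k)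
      (hA_root : ∀ j, T.Adj v j → A v j = √(y j) ∧ A j v = -√(y j))
      (hA_branch : ∀ (j : V) (h : T.Adj v j),
        IsConstructed (T.induce (treeBranch T v j)) ⟨j, mem_treeBranch_self T h⟩
          (gs j) (hs j) (principalSub A (treeBranch T v j)))
      (hA_root_zero : ∀ a, ¬ T.Adj v a → A v a = 0 ∧ A a v = 0)
      (hA_zero : ∀ a b, a ≠ v → b ≠ v →
        (∀ j, T.Adj v j → ¬ (a ∈ treeBranch T v j ∧ b ∈ treeBranch T v j)) → A a b = 0) :
      IsConstructed T v f g A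

/-! Partial fractions carry the proof. If `f` and `g` have symmetric, strictly interlacing roots
`iλ_j` and `iμ_p`, then `f/g = x + ∑ d_p/(x - iμ_p)`, where the residues `d_p` are positive and
invariant under `p ↦ p.rev` (`exists_partialNumerator_of_interlaces`). Conversely, take a
reversal-invariant set of poles with such weights. Its part of the sum is `y h / g'`, with `y` the
total weight, `g'` the monic polynomial whose roots are those poles, and `h` monic with symmetric
roots strictly interlacing them, by the intermediate value theorem
(`isInterlacingPair_of_weights_finset`).

A factorization of `g` over the neighbours of `v` is a colouring of the poles, and closure under
conjugation is reversal invariance of each colour class. Uniqueness of partial fractions then forces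
`y_j > 0` and makes each `(g_j, h_j)` again an interlacing pair, whatever factorization was chosen
(`IsInterlacingPair.of_decomposition`). An invariant colouring with prescribed class sizes exists
when at most one size is odd, and this is what nearly even branching provides
(`IsInterlacingPair.exists_decomposition`).

Deleting `v` leaves block diagonal branches, and the bordered determinant formula
(`charpoly_eq_of_bordered_blocks`), with `a_{vj} a_{jv} = -y_j`, gives `A` the characteristic
polynomial `x ∏ g_j + ∑ y_j h_j ∏_{k ≠ j} g_k = f`. Induction on the order of the tree finishes, and
the interlacing at every level of the recursion is the Duarte property. -/

section Branches

/-! ### Branches of a tree at a vertex. -/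

variable {V : Type u} {T : SimpleGraph V} {v : V}

theorem ne_of_mem_treeBranch {j x : V} (h : x ∈ treeBranch T v j) : x ≠ v :=
  h.2.1

theorem exists_adj_mem_treeBranch (hT : T.Connected) {x : V} (hx : x ≠ v) :
    ∃ j, T.Adj v j ∧ x ∈ treeBranch T v j := by
  obtain ⟨p, hp⟩ := (hT.preconnected v x).exists_isPath
  cases p with
  | nil => exact absurd rfl hx
  | @cons _ j _ h q =>
    rw [SimpleGraph.Walk.cons_isPath_iff] at hp
    refine ⟨j, h, h.ne', hx, ⟨q.induce _ fun a ha => ?_⟩⟩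
    rintro rfl
    exact hp.2 ha

/-- A path from `i` to `j` avoiding `v`, preceded by the edge `vi`, is a path from `v` through its
neighbour `j`; in a forest such a neighbour must be the second vertex of the path, which is `i`. -/
theorem eq_of_mem_treeBranch (hT : T.IsAcyclic) {i j x : V} (hi : T.Adj v i) (hj : T.Adj v j)
    (hxi : x ∈ treeBranch T v i) (hxj : x ∈ treeBranch T v j) : i = j := by
  obtain ⟨_, _, ri⟩ := hxi
  obtain ⟨_, _, rj⟩ := hxj
  obtain ⟨p, hp⟩ := (ri.trans rj.symm).exists_isPath
  let φ := (SimpleGraph.Embedding.induce (G := T) ({v}ᶜ : Set V))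
  obtain ⟨q, hq, hv⟩ : ∃ q : T.Walk i j, q.IsPath ∧ v ∉ q.support := by
    refine ⟨p.map φ.toHom, hp.map φ.injective, fun h => ?_⟩
    obtain ⟨a, -, ha⟩ := List.mem_map.1 ((SimpleGraph.Walk.support_map φ.toHom p) ▸ h)
    exact a.2 ha
  simpa using (hT.eq_snd_of_adj_start ((SimpleGraph.Walk.cons_isPath_iff hi _).2 ⟨hq, hv⟩) hj
    (by simp)).symm

theorem mem_treeBranch_of_adj {j a b : V} (ha : a ∈ treeBranch T v j) (hab : T.Adj a b)
    (hb : b ≠ v) : b ∈ treeBranch T v j := by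
  obtain ⟨hj, ha', r⟩ := ha
  refine ⟨hj, hb, r.trans (SimpleGraph.Adj.reachable ?_)⟩
  simpa using hab

theorem image_supp_connectedComponentMk {j : V} (hj : T.Adj v j) :
    Subtype.val '' ((T.induce ({v}ᶜ : Set V)).connectedComponentMk ⟨j, hj.ne'⟩).supp =
      treeBranch T v j := by
  ext x
  simp only [Set.mem_image, SimpleGraph.ConnectedComponent.mem_supp_iff,
    SimpleGraph.ConnectedComponent.eq]
  constructor
  · rintro ⟨a, ha, rfl⟩
    exact ⟨hj.ne', a.2, ha.symm⟩
  · rintro ⟨h1, h2, h3⟩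
    exact ⟨⟨x, h2⟩, h3.symm, rfl⟩

theorem ncard_supp_connectedComponentMk {j : V} (hj : T.Adj v j) :
    ((T.induce ({v}ᶜ : Set V)).connectedComponentMk ⟨j, hj.ne'⟩).supp.ncard =
      (treeBranch T v j).ncard := by
  rw [← image_supp_connectedComponentMk hj, Set.ncard_image_of_injective _ Subtype.val_injective]

theorem IsNEB.isTree (h : IsNEB T v) : T.IsTree := by
  cases h <;> assumption

theorem IsNEB.branch (h : IsNEB T v) {j : V} (hj : T.Adj v j) :
    IsNEB (T.induce (treeBranch T v j)) ⟨j, mem_treeBranch_self T hj⟩ := by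
  cases h with
  | single _ _ _ hn =>
    rw [Nat.card_eq_one_iff_unique] at hn
    obtain ⟨_, _⟩ := hn
    exact absurd (Subsingleton.elim v j) hj.ne
  | step _ _ _ _ _ _ hb => exact hb j hj

/-- All that the construction needs from the two parity conditions: whatever the parity of the order
of `T`, at most one branch at `v` is odd. -/
theorem IsNEB.eq_of_odd_ncard_treeBranch [Finite V] (h : IsNEB T v) {i j : V}
    (hi : T.Adj v i) (hj : T.Adj v j) (oi : Odd (treeBranch T v i).ncard)
    (oj : Odd (treeBranch T v j).ncard) : i = j := by
  have hT := h.isTree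
  cases h with
  | single _ _ _ hn =>
    rw [Nat.card_eq_one_iff_unique] at hn
    obtain ⟨_, _⟩ := hn
    exact Subsingleton.elim i j
  | step _ _ _ _ he ho _ =>
    rw [← ncard_supp_connectedComponentMk hi] at oi
    rw [← ncard_supp_connectedComponentMk hj] at oj
    rcases Nat.even_or_odd (Nat.card V) with hc | hc
    · obtain ⟨c, hc⟩ := Set.ncard_eq_one.1 (he hc)
      have h1 : (T.induce ({v}ᶜ : Set V)).connectedComponentMk ⟨i, hi.ne'⟩ = c := by
        rw [← Set.mem_singleton_iff, ← hc]; exact oi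
      have h2 : (T.induce ({v}ᶜ : Set V)).connectedComponentMk ⟨j, hj.ne'⟩ = c := by
        rw [← Set.mem_singleton_iff, ← hc]; exact oj
      have h3 := image_supp_connectedComponentMk hi
      rw [h1, ← h2, image_supp_connectedComponentMk hj] at h3
      exact eq_of_mem_treeBranch hT.isAcyclic hi hj (mem_treeBranch_self T hi)
        (h3 ▸ mem_treeBranch_self T hi)
    · exact absurd (show _ ∈ (T.induce ({v}ᶜ : Set V)).oddComponents from oi) (by simp [ho hc])

open Classical in
theorem sum_card_treeBranch [Fintype V] (hT : T.IsTree) :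
    ∑ j ∈ T.neighborFinset v, Fintype.card (treeBranch T v j) + 1 = Fintype.card V := by
  have h1 : (Finset.univ.erase v : Finset V) =
      (T.neighborFinset v).biUnion fun j => (treeBranch T v j).toFinset := by
    ext x
    simp only [Finset.mem_erase, Finset.mem_univ, and_true, Finset.mem_biUnion,
      SimpleGraph.mem_neighborFinset, Set.mem_toFinset]
    exact ⟨fun hx => exists_adj_mem_treeBranch hT.connected hx,
      fun ⟨j, _, h⟩ => ne_of_mem_treeBranch h⟩
  have h2 := Finset.card_erase_add_one (Finset.mem_univ v)
  rw [h1, Finset.card_biUnion] at h2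
  · simpa using h2
  · intro i hi j hj hij
    refine Finset.disjoint_left.2 fun x hx hx' => ?_
    simp only [Set.mem_toFinset, Finset.mem_coe, SimpleGraph.mem_neighborFinset] at hx hx' hi hj
    exact hij (eq_of_mem_treeBranch hT.isAcyclic hi hj hx hx')

end Branches

/-! ### Characteristic polynomials of bordered block diagonal matrices. -/

theorem Matrix.adjugate_apply_self_eq_det_submatrix {n R : Type*} [Fintype n] [DecidableEq n]
    [CommRing R] (N : Matrix n n R) (v : n) [Fintype ({v}ᶜ : Set n)] [DecidableEq ({v}ᶜ : Set n)] :
    N.adjugate v v =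
      (N.submatrix (Subtype.val : ({v}ᶜ : Set n) → n) (Subtype.val : ({v}ᶜ : Set n) → n)).det := by
  -- With row `v` replaced by a unit vector the matrix is block triangular, and its block at `v` is
  -- the 1×1 identity.
  rw [Matrix.adjugate_apply, Matrix.twoBlockTriangular_det' _ (fun x => x = v)]
  · have h1 : ((N.updateRow v (Pi.single v 1)).toSquareBlockProp fun x => x = v).det = 1 := by
      rw [Matrix.det_eq_elem_of_subsingleton _ (⟨v, rfl⟩ : {x // x = v})]
      simp [Matrix.toSquareBlockProp]
    let e : ({v}ᶜ : Set n) ≃ {x // ¬ x = v} := Equiv.refl _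
    rw [← Matrix.det_submatrix_equiv_self e]
    refine (congrArg₂ (· * ·) ?_ rfl).trans ((one_mul _).trans (congrArg Matrix.det ?_))
    · convert h1
    · ext ⟨i, hi⟩ ⟨j, hj⟩
      exact congrFun (Matrix.updateRow_ne (show i ≠ v from hi)) j
  · rintro i rfl j hj
    simp [hj]

theorem Matrix.charmatrix_submatrix_injective {m n R : Type*} [Fintype m] [Fintype n]
    [DecidableEq m] [DecidableEq n]
    [CommRing R] (M : Matrix n n R) {φ : m → n} (hφ : Function.Injective φ) :
    (M.submatrix φ φ).charmatrix = M.charmatrix.submatrix φ φ := by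
  ext1 i j
  simp [Matrix.charmatrix_apply, Matrix.diagonal_apply, hφ.eq_iff]

theorem Matrix.charpoly_eq_of_equiv {m n R : Type*} [Fintype m] [Fintype n]
    [DecidableEq m] [DecidableEq n] [CommRing R] (e : m ≃ n) {A : Matrix m m R} {B : Matrix n n R}
    (h : ∀ i j, A i j = B (e i) (e j)) : A.charpoly = B.charpoly := by
  rw [← Matrix.charpoly_reindex e A]
  congr 1
  ext1 i j
  simp [h]

section BorderedBlocks

variable {V R : Type*} [Fintype V] [CommRing R] {v : V} {N : Finset V} {S : V → Set V}

open Classical in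
theorem charpoly_submatrix_compl_singleton_eq_prod
    (hv : ∀ j ∈ N, v ∉ S j) (hself : ∀ j ∈ N, j ∈ S j)
    (hcover : ∀ x, x ≠ v → ∃ j ∈ N, x ∈ S j)
    (hdisj : ∀ i ∈ N, ∀ j ∈ N, ∀ x, x ∈ S i → x ∈ S j → i = j)
    (M : Matrix V V R)
    (hM : ∀ i ∈ N, ∀ j ∈ N, i ≠ j → ∀ a ∈ S i, ∀ b ∈ S j, M a b = 0) :
    (M.submatrix (Subtype.val : ({v}ᶜ : Set V) → V) (Subtype.val : ({v}ᶜ : Set V) → V)).charpoly =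
      ∏ j ∈ N, (M.submatrix (Subtype.val : S j → V) (Subtype.val : S j → V)).charpoly := by
  -- The order only serves to state block triangularity; any order will do, since the blocks vanish
  -- on both sides of the diagonal.
  obtain ⟨_⟩ : Nonempty (LinearOrder V) :=
    ⟨LinearOrder.lift' (Fintype.equivFin V) (Fintype.equivFin V).injective⟩
  choose! b hbN hbS using hcover
  set M' := M.submatrix (Subtype.val : ({v}ᶜ : Set V) → V) (Subtype.val : ({v}ᶜ : Set V) → V)
  have htri : M'.BlockTriangular (fun x => b x) := by
    rintro ⟨x, hx⟩ ⟨y, hy⟩ hlt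
    exact hM _ (hbN x hx) _ (hbN y hy) hlt.ne' _ (hbS x hx) _ (hbS y hy)
  have key := htri.charpoly
  have himg : Finset.image (fun x : ({v}ᶜ : Set V) => b x) Finset.univ = N := by
    ext j
    simp only [Finset.mem_image, Finset.mem_univ, true_and]
    constructor
    · rintro ⟨x, rfl⟩
      exact hbN _ x.2
    · intro hj
      have hjv : j ≠ v := fun h => hv j hj (h ▸ hself j hj)
      exact ⟨⟨j, hjv⟩, hdisj _ (hbN j hjv) _ hj j (hbS j hjv) (hself j hj)⟩
  rw [himg] at key
  refine Eq.trans (by convert rfl) (key.trans ?_)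
  refine Finset.prod_congr rfl fun j hj => ?_
  symm
  have hjS : ∀ x ∈ S j, x ≠ v := fun x hx h => hv j hj (h ▸ hx)
  obtain ⟨e, he⟩ : ∃ e : S j ≃ {x : ({v}ᶜ : Set V) // b x = j}, ∀ x, ((e x).1 : V) = x :=
    ⟨{ toFun := fun x => ⟨⟨x.1, hjS x x.2⟩,
         hdisj _ (hbN _ (hjS x x.2)) _ hj _ (hbS _ (hjS x x.2)) x.2⟩
       invFun := fun x => ⟨x.1.1, by have := hbS _ x.1.2; rwa [x.2] at this⟩
       left_inv := fun x => rfl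
       right_inv := fun x => rfl }, fun x => rfl⟩
  have h0 : ∀ x y : S j, M.submatrix (Subtype.val : S j → V) (Subtype.val : S j → V) x y =
      M'.toSquareBlock (fun x => b x) j (e x) (e y) := by
    intro x y
    change M x y = M (e x).1 (e y).1
    rw [he, he]
  have h1 := Matrix.charpoly_eq_of_equiv e h0
  convert h1

open Classical in
-- A Schur complement at `v` without inverses. Columns of the adjugates of the blocks give a vector
-- `z` with `z v = G` that the characteristic matrix sends to `F • e_v`. Computing in two ways the
-- determinant with column `v` replaced by this image yields `G * M.charpoly = F * G`.
theorem charpoly_eq_of_bordered_blocks [IsDomain R]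
    (hv : ∀ j ∈ N, v ∉ S j) (hself : ∀ j ∈ N, j ∈ S j)
    (hcover : ∀ x, x ≠ v → ∃ j ∈ N, x ∈ S j)
    (hdisj : ∀ i ∈ N, ∀ j ∈ N, ∀ x, x ∈ S i → x ∈ S j → i = j)
    (M : Matrix V V R)
    (hM : ∀ i ∈ N, ∀ j ∈ N, i ≠ j → ∀ a ∈ S i, ∀ b ∈ S j, M a b = 0)
    (hrow : ∀ a ∉ N, M v a = 0) (hcol : ∀ a ∉ N, M a v = 0)
    (g h : V → R[X])
    (hg : ∀ j ∈ N, (M.submatrix (Subtype.val : S j → V) (Subtype.val : S j → V)).charpoly = g j)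
    (hh : ∀ j (hj : j ∈ N), ((M.submatrix (Subtype.val : S j → V) (Subtype.val : S j → V)).submatrix
        (Subtype.val : ({⟨j, hself j hj⟩}ᶜ : Set (S j)) → S j) Subtype.val).charpoly = h j) :
    M.charpoly = X * ∏ j ∈ N, g j -
      ∑ j ∈ N, C (M v j * M j v) * h j * ∏ k ∈ N.erase j, g k := by
  have hjv : ∀ j ∈ N, j ≠ v := fun j hj h => hv j hj (h ▸ hself j hj)
  have hvN : v ∉ N := fun h => hjv v h rfl
  have hprod := charpoly_submatrix_compl_singleton_eq_prod hv hself hcover hdisj M hM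
  rw [Finset.prod_congr rfl hg] at hprod
  set G := ∏ j ∈ N, g j with hG
  have hG0 : G ≠ 0 := hprod ▸ (Matrix.charpoly_monic _).ne_zero
  let B : ∀ j, Matrix (S j) (S j) R[X] := fun j =>
    (M.submatrix (Subtype.val : S j → V) (Subtype.val : S j → V)).charmatrix
  have hB : ∀ j, B j = M.charmatrix.submatrix Subtype.val Subtype.val := fun j =>
    Matrix.charmatrix_submatrix_injective M Subtype.val_injective
  choose! b hbN hbS using hcover
  have hb : ∀ j ∈ N, ∀ x ∈ S j, b x = j := fun j hj x hx => by
    have hxv : x ≠ v := fun h => hv j hj (h ▸ hx)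
    exact hdisj _ (hbN x hxv) _ hj x (hbS x hxv) hx
  -- Cramer: `w` and `z` solve the linear system with the value `G` at the border vertex.
  let w : ∀ j, V → R[X] := fun j x =>
    if hx : j ∈ N ∧ x ∈ S j then
      C (M j v) * (B j).adjugate ⟨x, hx.2⟩ ⟨j, hself j hx.1⟩ * ∏ k ∈ N.erase j, g k
    else 0
  let z : V → R[X] := fun x => if x = v then G else w (b x) x
  have hzv : z v = G := if_pos rfl
  have hz : ∀ j (hj : j ∈ N) (x : S j), z x =
      C (M j v) * (B j).adjugate x ⟨j, hself j hj⟩ * ∏ k ∈ N.erase j, g k := by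
    intro j hj x
    have hxv : x.1 ≠ v := fun h => hv j hj (h ▸ x.2)
    simp only [z, if_neg hxv, hb j hj x x.2]
    exact dif_pos (show j ∈ N ∧ x.1 ∈ S j from ⟨hj, x.2⟩)
  set F := X * G - ∑ j ∈ N, C (M v j * M j v) * h j * ∏ k ∈ N.erase j, g k with hF
  have hadj : ∀ j (hj : j ∈ N), (B j).adjugate ⟨j, hself j hj⟩ ⟨j, hself j hj⟩ = h j := by
    intro j hj
    rw [Matrix.adjugate_apply_self_eq_det_submatrix, ← hh j hj, Matrix.charpoly,
      Matrix.charmatrix_submatrix_injective _ Subtype.val_injective]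
  have hNv : (M.charmatrix.mulVec z) v = F := by
    have hsub : ∑ x, M.charmatrix v x * z x = ∑ x ∈ insert v N, M.charmatrix v x * z x := by
      refine (Finset.sum_subset (Finset.subset_univ _) fun x _ hx => ?_).symm
      rw [Finset.mem_insert, not_or] at hx
      simp [Matrix.charmatrix_apply_ne _ _ _ (Ne.symm hx.1), hrow x hx.2]
    rw [Matrix.mulVec, dotProduct, hsub, Finset.sum_insert hvN, hzv, Matrix.charmatrix_apply_eq,
      hrow v hvN, C_0, sub_zero, hF, sub_eq_add_neg, ← Finset.sum_neg_distrib]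
    congr 1
    refine Finset.sum_congr rfl fun j hj => ?_
    rw [Matrix.charmatrix_apply_ne _ _ _ (hjv j hj).symm, hz j hj ⟨j, hself j hj⟩, hadj j hj, C_mul]
    ring
  have hNx : ∀ x, x ≠ v → (M.charmatrix.mulVec z) x = 0 := by
    intro x hx
    have hj := hbN x hx
    have hxS := hbS x hx
    set j := b x
    have hvS : v ∉ (S j).toFinset := by simpa using hv j hj
    have hsub : ∑ y, M.charmatrix x y * z y =
        ∑ y ∈ insert v (S j).toFinset, M.charmatrix x y * z y := by
      refine (Finset.sum_subset (Finset.subset_univ _) fun y _ hy => ?_).symm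
      rw [Finset.mem_insert, not_or, Set.mem_toFinset] at hy
      have hxy : x ≠ y := fun h => hy.2 (h ▸ hxS)
      have hne : j ≠ b y := fun h => hy.2 (h ▸ hbS y hy.1)
      simp [Matrix.charmatrix_apply_ne _ _ _ hxy, hM _ hj _ (hbN y hy.1) hne _ hxS _ (hbS y hy.1)]
    have hdet : (B j).det = g j := hg j hj
    have hblock : ∑ y ∈ (S j).toFinset, M.charmatrix x y * z y =
        C (M j v) * (∏ k ∈ N.erase j, g k) * ((B j) * (B j).adjugate) ⟨x, hxS⟩ ⟨j, hself j hj⟩ := by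
      rw [Matrix.mul_apply, Finset.mul_sum, Finset.sum_subtype _ (fun y => Set.mem_toFinset)]
      refine Finset.sum_congr rfl fun y _ => ?_
      rw [hz j hj y, hB]
      simp only [Matrix.submatrix_apply]
      ring
    rw [Matrix.mulVec, dotProduct, hsub, Finset.sum_insert hvS, hzv, hblock,
      Matrix.charmatrix_apply_ne _ _ _ hx, Matrix.mul_adjugate, hdet, hG,
      ← Finset.mul_prod_erase N g hj]
    by_cases hxj : x = j
    · have hx' : (⟨x, hxS⟩ : S j) = ⟨j, hself j hj⟩ := Subtype.ext hxj
      rw [hx', Matrix.smul_apply, Matrix.one_apply_eq, smul_eq_mul, mul_one,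
        show M x v = M j v from congrArg (M · v) hxj]
      ring
    -- Each block meets `N` only in its own index, so `v` is joined to no other vertex of the block.
    · have hxN : x ∉ N := fun h => hxj (hdisj x h j hj x (hself x h) hxS)
      simp [hcol x hxN, Matrix.one_apply_ne, hxj]
  have h1 : (M.charmatrix.updateCol v (M.charmatrix.mulVec z)).det = G * M.charpoly := by
    have := Matrix.det_updateCol_sum M.charmatrix v z
    rw [hzv] at this
    rw [Matrix.charpoly, ← smul_eq_mul, ← this]
    congr 2
    ext1 k
    simp [Matrix.mulVec, dotProduct, mul_comm]
  have h2 : M.charmatrix.mulVec z = F • Pi.single v 1 := by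
    ext1 x
    by_cases hx : x = v
    · subst hx; simp [hNv]
    · simp [hNx x hx, hx]
  have h3 : (M.charmatrix.updateCol v (Pi.single v 1)).det = G := by
    rw [← Matrix.cramer_apply, Matrix.cramer_eq_adjugate_mulVec, Matrix.mulVec_single_one,
      Matrix.col_apply, Matrix.adjugate_apply_self_eq_det_submatrix, ← hprod, Matrix.charpoly,
      Matrix.charmatrix_submatrix_injective _ Subtype.val_injective]
  rw [h2, Matrix.det_updateCol_smul, h3, mul_comm] at h1
  exact (mul_left_cancel₀ hG0 h1).symm

end BorderedBlocks

/-! ### Colourings invariant under reversal. -/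

section ColourClasses

/-- Induction in steps of two: the first and last positions are exchanged by reversal and go to a
class of size at least two. Removing them changes no parity. -/
theorem exists_rev_invariant_colouring {α : Type*} [DecidableEq α] (s : Finset α) :
    ∀ (k : ℕ) (n : α → ℕ), ∑ j ∈ s, n j = k →
      (∀ i ∈ s, ∀ j ∈ s, Odd (n i) → Odd (n j) → i = j) →
      ∃ c : Fin k → α, (∀ p, c p ∈ s) ∧ (∀ p, c p.rev = c p) ∧
        ∀ j ∈ s, (Finset.univ.filter fun p => c p = j).card = n j := by
  intro k
  induction k using Nat.twoStepInduction with
  | zero =>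
    intro n hn _
    refine ⟨Fin.elim0, fun p => p.elim0, fun p => p.elim0, fun j hj => ?_⟩
    rw [Finset.sum_eq_zero_iff] at hn
    simp [hn j hj]
  | one =>
    intro n hn _
    obtain ⟨i, hi, hni⟩ : ∃ i ∈ s, n i ≠ 0 := by
      by_contra! h
      rw [Finset.sum_eq_zero h] at hn
      omega
    refine ⟨fun _ => i, fun _ => hi, fun _ => rfl, fun j hj => ?_⟩
    rw [← Finset.add_sum_erase _ _ hi] at hn
    by_cases hij : i = j
    · subst hij
      simp
      omega
    · have : n j ≤ ∑ x ∈ s.erase i, n x :=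
        Finset.single_le_sum (f := n) (fun _ _ => Nat.zero_le _)
          (Finset.mem_erase.2 ⟨Ne.symm hij, hj⟩)
      simp [hij]
      omega
  | more k ih _ =>
    intro n hn ho
    obtain ⟨i, hi, hni⟩ : ∃ i ∈ s, 2 ≤ n i := by
      -- If all sizes were at most one, every nonempty class would be odd, so there would be at most
      -- one of them, and the total would be less than `k + 2`.
      by_contra! h
      obtain ⟨i, hi, hni⟩ : ∃ i ∈ s, n i ≠ 0 := by
        by_contra! h
        rw [Finset.sum_eq_zero h] at hn
        omega
      have hodd : ∀ j ∈ s, n j ≠ 0 → Odd (n j) := fun j hj h0 => by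
        have := h j hj
        rw [show n j = 1 by omega]
        exact odd_one
      have h1 : ∑ j ∈ s, n j = n i := by
        refine Finset.sum_eq_single_of_mem i hi fun j hj hji => ?_
        by_contra h0
        exact hji (ho j hj i hi (hodd j hj h0) (hodd i hi hni))
      have := h i hi
      omega
    obtain ⟨c, hcs, hcr, hcn⟩ := ih (fun j => if j = i then n j - 2 else n j) (by
        have h1 := Finset.add_sum_erase s n hi
        have h2 := Finset.add_sum_erase s (fun j => if j = i then n j - 2 else n j) hi
        have h3 : ∑ j ∈ s.erase i, (if j = i then n j - 2 else n j) = ∑ j ∈ s.erase i, n j :=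
          Finset.sum_congr rfl fun j hj => if_neg (Finset.ne_of_mem_erase hj)
        simp only [if_true] at h2
        omega) (by
        have hodd : ∀ j, Odd (if j = i then n j - 2 else n j) → Odd (n j) := by
          intro j hj
          split_ifs at hj with h
          · subst h
            rw [← Nat.sub_add_cancel hni]
            exact hj.add_even even_two
          · exact hj
        exact fun a ha b hb oa ob => ho a ha b hb (hodd a oa) (hodd b ob))
    refine ⟨Fin.cons i (Fin.snoc c i : Fin (k + 1) → α), ?_, ?_, ?_⟩
    · intro p
      refine Fin.cases hi (fun p => ?_) p
      refine Fin.lastCases ?_ (fun p => ?_) p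
      · simpa using hi
      · simpa using hcs p
    · intro p
      refine Fin.cases ?_ (fun p => ?_) p
      · rw [Fin.rev_zero, ← Fin.succ_last]
        simp
      · refine Fin.lastCases ?_ (fun p => ?_) p
        · rw [Fin.succ_last, Fin.rev_last, Fin.cons_zero, ← Fin.succ_last]
          simp
        · rw [Fin.rev_succ, Fin.rev_castSucc, ← Fin.succ_castSucc]
          simpa using hcr p
    · intro j hj
      have := hcn j hj
      rw [Finset.card_filter] at this ⊢
      rw [Fin.sum_univ_succ, Fin.sum_univ_castSucc]
      simp only [Fin.cons_zero, Fin.cons_succ, Fin.snoc_castSucc, Fin.snoc_last]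
      rw [this]
      by_cases hij : j = i
      · subst hij
        simp
        omega
      · simp [hij, Ne.symm hij]

end ColourClasses

/-! ### Numerators of partial fraction sums. -/

section PartialFractions

variable {ι : Type*} [DecidableEq ι]

/-- The numerator of the partial fraction sum `∑ d p / (X - a p)` over the common denominator
`∏ (X - a p)`. -/
noncomputable def partialNumerator {K : Type*} [Field K] (s : Finset ι) (d a : ι → K) : K[X] :=
  ∑ p ∈ s, C (d p) * ∏ q ∈ s.erase p, (X - C (a q))

variable {K : Type*} [Field K] (s : Finset ι) (d a : ι → K)

theorem degree_partialNumerator_lt : (partialNumerator s d a).degree < s.card := by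
  refine (degree_sum_le _ _).trans_lt ((Finset.sup_lt_iff (WithBot.bot_lt_coe _)).2 fun p hp => ?_)
  have h0 : (C (d p)).degree ≤ 0 := degree_C_le
  refine (degree_mul_le_of_le h0 le_rfl).trans_lt ?_
  rw [zero_add]
  rw [degree_eq_natDegree (monic_prod_X_sub_C _ _).ne_zero,
    natDegree_finsetProd_X_sub_C_eq_card]
  exact_mod_cast Finset.card_erase_lt_of_mem hp

theorem eval_partialNumerator (x : K) :
    (partialNumerator s d a).eval x = ∑ p ∈ s, d p * ∏ q ∈ s.erase p, (x - a q) := by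
  simp [partialNumerator, eval_finsetSum, eval_prod]

variable {s}

theorem eval_partialNumerator_node {p : ι} (hp : p ∈ s) :
    (partialNumerator s d a).eval (a p) = d p * ∏ q ∈ s.erase p, (a p - a q) := by
  rw [eval_partialNumerator]
  refine Finset.sum_eq_single_of_mem p hp fun q _ hqp => ?_
  rw [Finset.prod_eq_zero (Finset.mem_erase.2 ⟨hqp.symm, hp⟩) (sub_self _), mul_zero]

theorem coeff_partialNumerator {r : ℕ} (hs : s.card = r + 1) :
    (partialNumerator s d a).coeff r = ∑ p ∈ s, d p := by
  rw [partialNumerator, finsetSum_coeff]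
  refine Finset.sum_congr rfl fun p hp => ?_
  have h1 : (∏ q ∈ s.erase p, (X - C (a q))).natDegree = r := by
    rw [natDegree_finsetProd_X_sub_C_eq_card, Finset.card_erase_of_mem hp, hs]; rfl
  have h2 := (monic_prod_X_sub_C a (s.erase p)).coeff_natDegree
  rw [h1] at h2
  rw [coeff_C_mul, h2, mul_one]

/-- The two top coefficients cancel: both products are monic, and their next coefficients are minus
the sums of the roots. -/
theorem degree_prod_X_sub_C_sub_prod_X_sub_C_lt {k : ℕ} (a b : Fin (k + 1) → K)
    (h : ∑ j, a j = ∑ j, b j) :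
    (∏ j, (X - C (a j)) - ∏ j, (X - C (b j))).degree < (k : WithBot ℕ) := by
  have hd : ∀ a : Fin (k + 1) → K, (∏ j, (X - C (a j))).natDegree = k + 1 := fun a => by
    simp [natDegree_finsetProd_X_sub_C_eq_card]
  have h1 : ∀ a : Fin (k + 1) → K, (∏ j, (X - C (a j))).coeff (k + 1) = 1 := fun a => by
    have := (monic_prod_X_sub_C a Finset.univ).coeff_natDegree
    rwa [hd] at this
  have h2 : ∀ a : Fin (k + 1) → K, (∏ j, (X - C (a j))).coeff k = -∑ j, a j := fun a => by
    have := prod_X_sub_C_nextCoeff (s := Finset.univ) a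
    rwa [nextCoeff_of_natDegree_pos (by rw [hd]; omega), hd] at this
  rw [degree_lt_iff_coeff_zero]
  intro m hm
  rw [coeff_sub]
  rcases hm.eq_or_lt with rfl | hm
  · rw [h2, h2, h, sub_self]
  · rcases (Nat.succ_le_of_lt hm).eq_or_lt with hm | hm
    · rw [← hm, Nat.succ_eq_add_one, h1, h1, sub_self]
    · rw [coeff_eq_zero_of_natDegree_lt (by rw [hd]; exact hm),
        coeff_eq_zero_of_natDegree_lt (by rw [hd]; exact hm), sub_self]

end PartialFractions

/-! ### From interlacing to positive symmetric residues. -/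

section Interlacing

theorem strictMono_of_interlaces {k : ℕ} {l : Fin (k + 1) → ℝ} {m : Fin k → ℝ}
    (h : ∀ j : Fin k, l j.castSucc < m j ∧ m j < l j.succ) : StrictMono l ∧ StrictMono m := by
  have hl : StrictMono l := Fin.strictMono_iff_lt_succ.2 fun j => (h j).1.trans (h j).2
  refine ⟨hl, fun i j hij => (h i).2.trans_le ((hl.monotone ?_).trans (h j).1.le)⟩
  rw [Fin.le_def]
  exact hij

theorem sum_eq_zero_of_rev {k : ℕ} {l : Fin k → ℝ} (h : ∀ j, l j = -l j.rev) : ∑ j, l j = 0 := by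
  have h1 : ∑ j, l j = -∑ j, l j := by
    conv_lhs => rw [Finset.sum_congr rfl fun j _ => h j, Finset.sum_neg_distrib]
    rw [← Equiv.sum_comp Fin.revPerm l]
    rfl
  linarith

/-- Pair `m q` with `l q.castSucc` when `q < p` and with `l q.succ` when `q > p`: each quotient is
positive. The two factors left over involve the neighbours of `m p` in `l`, one on each side, and
have opposite signs. -/
theorem prod_sub_div_prod_sub_neg {k : ℕ} {l : Fin (k + 1) → ℝ} {m : Fin k → ℝ}
    (h : ∀ j : Fin k, l j.castSucc < m j ∧ m j < l j.succ) (p : Fin k) :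
    (∏ j, (m p - l j)) / ∏ q ∈ Finset.univ.erase p, (m p - m q) < 0 := by
  obtain ⟨hl, hm⟩ := strictMono_of_interlaces h
  rw [Fin.prod_univ_succAbove _ p.castSucc, ← Finset.mul_prod_erase _ _ (Finset.mem_univ p),
    Fin.succAbove_castSucc_self, ← mul_assoc, mul_div_assoc, ← Finset.prod_div_distrib]
  refine mul_neg_of_neg_of_pos (mul_neg_of_pos_of_neg (sub_pos.2 (h p).1) (sub_neg.2 (h p).2))
    (Finset.prod_pos fun q hq => ?_)
  rcases lt_or_gt_of_ne (Finset.ne_of_mem_erase hq) with hqp | hqp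
  · rw [Fin.succAbove_of_castSucc_lt _ _ (by simpa using hqp)]
    exact div_pos (sub_pos.2 ((h q).1.trans (hm hqp))) (sub_pos.2 (hm hqp))
  · rw [Fin.succAbove_of_le_castSucc _ _ (by simpa using hqp.le)]
    exact div_pos_of_neg_of_neg (sub_neg.2 ((hm hqp).trans (h q).2)) (sub_neg.2 (hm hqp))

theorem prod_erase_rev {M : Type*} [CommMonoid M] {k : ℕ} (p : Fin k) (φ : Fin k → M) :
    ∏ q ∈ Finset.univ.erase p.rev, φ q = ∏ q ∈ Finset.univ.erase p, φ q.rev :=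
  (Finset.prod_bij (fun q _ => q.rev) (fun q hq => by simpa using hq) (fun _ _ _ _ h => by simpa using h)
    (fun q hq => ⟨q.rev, by simpa [Fin.rev_eq_iff] using hq, by simp⟩) fun q _ => rfl).symm

/-- By symmetry both root sums vanish, so `f - X * g` has degree below `k` and is determined by its
values at the `k` roots of `g`. The weights are the residues of `f/g`. -/
theorem exists_partialNumerator_of_interlaces {k : ℕ} {l : Fin (k + 1) → ℝ} {m : Fin k → ℝ}
    (h : ∀ j : Fin k, l j.castSucc < m j ∧ m j < l j.succ)
    (hl : ∀ j, l j = -l j.rev) (hm : ∀ j, m j = -m j.rev) :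
    ∃ d : Fin k → ℝ, (∀ p, 0 < d p) ∧ (∀ p, d p.rev = d p) ∧
      ∏ j, (X - C (Complex.I * (l j : ℂ))) = X * ∏ j, (X - C (Complex.I * (m j : ℂ))) +
        partialNumerator Finset.univ (fun p => (d p : ℂ)) (fun p => Complex.I * (m p : ℂ)) := by
  let d : Fin k → ℝ := fun p =>
    -((∏ j, (m p - l j)) / ∏ q ∈ Finset.univ.erase p, (m p - m q))
  refine ⟨d, fun p => neg_pos.2 (prod_sub_div_prod_sub_neg h p), fun p => ?_, ?_⟩
  · have hmr : m p.rev = -m p := by rw [hm p, neg_neg]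
    have h1 : ∏ j, (m p.rev - l j) = (-1) ^ (k + 1) * ∏ j, (m p - l j) := by
      rw [← Equiv.prod_comp Fin.revPerm, ← Fin.prod_const, ← Finset.prod_mul_distrib]
      refine Finset.prod_congr rfl fun j _ => ?_
      rw [hmr, Fin.revPerm_apply, hl j]; ring
    have h2 : ∏ q ∈ Finset.univ.erase p.rev, (m p.rev - m q) =
        (-1) ^ (k - 1) * ∏ q ∈ Finset.univ.erase p, (m p - m q) := by
      rw [prod_erase_rev]
      have : (Finset.univ.erase p).card = k - 1 := by simp
      rw [← this, ← Finset.prod_const, ← Finset.prod_mul_distrib]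
      refine Finset.prod_congr rfl fun j _ => ?_
      rw [hmr, hm j]; ring
    -- The existence of `p` gives `k ≥ 1`, so the subtraction `k - 1` is not truncated.
    have h3 : ((-1 : ℝ) ^ (k + 1)) = (-1) ^ (k - 1) := by
      obtain ⟨k, rfl⟩ : ∃ k', k = k' + 1 := ⟨k - 1, by have := p.pos; omega⟩
      simp [pow_succ]
    simp only [d]
    rw [h1, h2, h3, mul_div_mul_left _ _ (pow_ne_zero _ (by norm_num))]
  · have hinj : Function.Injective fun p => Complex.I * (m p : ℂ) := fun p q hpq => by
      have := mul_left_cancel₀ Complex.I_ne_zero hpq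
      exact (strictMono_of_interlaces h).2.injective (by exact_mod_cast this)
    rw [← sub_eq_iff_eq_add']
    refine eq_of_degrees_lt_of_eval_index_eq Finset.univ hinj.injOn ?_
      (degree_partialNumerator_lt _ _ _) fun p _ => ?_
    -- The factor `X` counts as one more root, equal to `0`, so that both products have `k + 1`
    -- factors.
    · have h1 : X * ∏ j, (X - C (Complex.I * (m j : ℂ))) = ∏ j : Fin (k + 1),
          (X - C ((Fin.cons 0 fun j => Complex.I * (m j : ℂ) : Fin (k + 1) → ℂ) j)) := by
        simp [Fin.prod_univ_succ]
      rw [h1, Finset.card_fin]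
      refine degree_prod_X_sub_C_sub_prod_X_sub_C_lt _ _ ?_
      rw [Fin.sum_univ_succ (Fin.cons 0 fun j => Complex.I * (m j : ℂ) : Fin (k + 1) → ℂ)]
      simp only [Fin.cons_zero, Fin.cons_succ, zero_add, ← Finset.mul_sum]
      congr 1
      exact_mod_cast (sum_eq_zero_of_rev hl).trans (sum_eq_zero_of_rev hm).symm
    · rw [eval_partialNumerator_node (fun p => (d p : ℂ)) (fun p => Complex.I * (m p : ℂ))
        (Finset.mem_univ p)]
      simp only [eval_sub, eval_mul, eval_X, eval_prod, eval_C]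
      rw [Finset.prod_eq_zero (Finset.mem_univ p) (sub_self _), mul_zero, sub_zero]
      simp only [← mul_sub, Finset.prod_mul_distrib, Finset.prod_const]
      have hne : (∏ q ∈ Finset.univ.erase p, (m p - m q)) ≠ 0 :=
        Finset.prod_ne_zero_iff.2 fun q hq => sub_ne_zero.2
          ((strictMono_of_interlaces h).2.injective.ne (Finset.ne_of_mem_erase hq).symm)
      have hd : ∏ j, (m p - l j) = -(d p * ∏ q ∈ Finset.univ.erase p, (m p - m q)) := by
        simp only [d]
        field_simp
      -- The quotient `i^(k+1) / i^(k-1) = -1` turns the negative real quotient into a positive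
      -- residue.
      have hI : Complex.I ^ (k + 1) = -Complex.I ^ (k - 1) := by
        obtain ⟨k, rfl⟩ : ∃ k', k = k' + 1 := ⟨k - 1, by have := p.pos; omega⟩
        simp only [Nat.add_sub_cancel, pow_succ]
        rw [mul_assoc, Complex.I_mul_I]; ring
      have hd' : ∏ j, ((m p : ℂ) - l j) =
          -((d p : ℂ) * ∏ q ∈ Finset.univ.erase p, ((m p : ℂ) - m q)) := by exact_mod_cast congrArg Complex.ofReal hd
      rw [hd']
      simp [hI]
      ring

end Interlacing

/-! ### From positive symmetric weights to interlacing. -/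

section InterlacingPairs

/-- `f` and `g` have degrees `k + 1` and `k`, and simple roots on the imaginary axis which strictly
interlace and are symmetric about `0`. -/
def IsInterlacingPair (k : ℕ) (f g : ℂ[X]) : Prop :=
  ∃ (l : Fin (k + 1) → ℝ) (m : Fin k → ℝ),
    (∀ j : Fin k, l j.castSucc < m j ∧ m j < l j.succ) ∧
    (∀ j, l j = -l j.rev) ∧ (∀ j, m j = -m j.rev) ∧
    f = ∏ j, (X - C (Complex.I * (l j : ℂ))) ∧ g = ∏ j, (X - C (Complex.I * (m j : ℂ)))

theorem I_mul_ofReal_injective : Function.Injective fun x : ℝ => Complex.I * (x : ℂ) :=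
  fun x y hxy => by exact_mod_cast mul_left_cancel₀ Complex.I_ne_zero hxy

theorem prod_X_sub_C_dvd_of_eval_eq_zero {ι K : Type*} [Field K] {s : Finset ι} {a : ι → K}
    (ha : Set.InjOn a s) {f : K[X]} (h : ∀ p ∈ s, f.eval (a p) = 0) :
    ∏ p ∈ s, (X - C (a p)) ∣ f := by
  refine Finset.prod_dvd_of_coprime (fun p hp q hq hpq => ?_) fun p hp => dvd_iff_isRoot.2 (h p hp)
  exact isCoprime_X_sub_C_of_isUnit_sub (sub_ne_zero.2 fun h => hpq (ha hp hq h)).isUnit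

variable {r : ℕ} {μ d : Fin (r + 1) → ℝ}

/-- At a node only its own term survives. Between consecutive nodes just one factor of that term
changes sign, so the sum changes sign and has a zero. -/
theorem exists_root_between (hμ : StrictMono μ) (hd : ∀ p, 0 < d p) (j : Fin r) :
    ∃ x, (μ j.castSucc < x ∧ x < μ j.succ) ∧
      ∑ p, d p * ∏ q ∈ Finset.univ.erase p, (x - μ q) = 0 := by
  set Q : ℝ → ℝ := fun x => ∑ p, d p * ∏ q ∈ Finset.univ.erase p, (x - μ q) with hQ
  have hnode : ∀ p, Q (μ p) = d p * ∏ q ∈ Finset.univ.erase p, (μ p - μ q) := fun p => by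
    have := eval_partialNumerator_node d μ (Finset.mem_univ p)
    rwa [eval_partialNumerator] at this
  have hcont : Continuous Q := by fun_prop
  have hlt : j.castSucc < j.succ := Fin.castSucc_lt_succ
  have hneg : Q (μ j.castSucc) * Q (μ j.succ) < 0 := by
    rw [hnode, hnode,
      ← Finset.mul_prod_erase _ _ (Finset.mem_erase.2 ⟨hlt.ne', Finset.mem_univ j.succ⟩),
      ← Finset.mul_prod_erase (Finset.univ.erase j.succ) _
        (Finset.mem_erase.2 ⟨hlt.ne, Finset.mem_univ j.castSucc⟩), Finset.erase_right_comm]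
    -- No other node lies between the two, so each remaining node is on the same side of both.
    have h1 : 0 < (∏ q ∈ (Finset.univ.erase j.succ).erase j.castSucc, (μ j.castSucc - μ q)) *
        ∏ q ∈ (Finset.univ.erase j.succ).erase j.castSucc, (μ j.succ - μ q) := by
      rw [← Finset.prod_mul_distrib]
      refine Finset.prod_pos fun q hq => ?_
      have hq1 := Finset.ne_of_mem_erase hq
      have hq2 := Finset.ne_of_mem_erase (Finset.mem_of_mem_erase hq)
      rcases lt_or_gt_of_ne hq1 with h | h
      · exact mul_pos (sub_pos.2 (hμ h)) (sub_pos.2 (hμ (h.trans hlt)))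
      · have : j.succ < q := lt_of_le_of_ne (Fin.castSucc_lt_iff_succ_le.1 h) hq2.symm
        exact mul_pos_of_neg_of_neg (sub_neg.2 (hμ h)) (sub_neg.2 (hμ this))
    have h2 := hμ hlt
    have h3 : (μ j.castSucc - μ j.succ) * (μ j.succ - μ j.castSucc) < 0 :=
      mul_neg_of_neg_of_pos (sub_neg.2 h2) (sub_pos.2 h2)
    have h4 := mul_neg_of_pos_of_neg (mul_pos (hd j.castSucc) (hd j.succ))
      (mul_neg_of_neg_of_pos h3 h1)
    refine lt_of_eq_of_lt ?_ h4
    ring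
  have hle := (hμ hlt).le
  rcases mul_neg_iff.1 hneg with ⟨h1, h2⟩ | ⟨h1, h2⟩
  · obtain ⟨x, hx, hx0⟩ := intermediate_value_Ioo' hle hcont.continuousOn ⟨h2, h1⟩
    exact ⟨x, hx, hx0⟩
  · obtain ⟨x, hx, hx0⟩ := intermediate_value_Ioo hle hcont.continuousOn ⟨h1, h2⟩
    exact ⟨x, hx, hx0⟩

/-- On the imaginary axis the numerator is `i^r` times a real polynomial. The `r` zeros found
between consecutive nodes exhaust its degree, and its leading coefficient is the total weight. -/
theorem isInterlacingPair_of_weights (hμ : StrictMono μ) (hsymm : ∀ j, μ j = -μ j.rev)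
    (hd : ∀ p, 0 < d p) (hdsymm : ∀ p, d p.rev = d p) :
    ∃ h, IsInterlacingPair r (∏ j, (X - C (Complex.I * (μ j : ℂ)))) h ∧
      partialNumerator Finset.univ (fun p => (d p : ℂ)) (fun p => Complex.I * (μ p : ℂ)) =
        C ((∑ p, d p : ℝ) : ℂ) * h := by
  choose η hη hroot using exists_root_between hμ hd
  have hηmono : StrictMono η := (strictMono_of_interlaces hη).2
  set Q := partialNumerator Finset.univ (fun p => (d p : ℂ)) (fun p => Complex.I * (μ p : ℂ)) with hQ
  have hIeval : ∀ x : ℝ, Q.eval (Complex.I * (x : ℂ)) = Complex.I ^ r *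
      ((∑ p, d p * ∏ q ∈ Finset.univ.erase p, (x - μ q) : ℝ) : ℂ) := by
    intro x
    rw [hQ, eval_partialNumerator]
    push_cast
    rw [Finset.mul_sum]
    refine Finset.sum_congr rfl fun p _ => ?_
    simp only [← mul_sub, Finset.prod_mul_distrib, Finset.prod_const]
    simp
    ring
  have hdvd : ∏ j, (X - C (Complex.I * (η j : ℂ))) ∣ Q := by
    refine prod_X_sub_C_dvd_of_eval_eq_zero
      (fun i _ j _ h => hηmono.injective (I_mul_ofReal_injective h)) fun j _ => ?_
    rw [hIeval, hroot]
    simp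
  have hdeg : (∏ j, (X - C (Complex.I * (η j : ℂ)))).natDegree = r := by
    rw [natDegree_finsetProd_X_sub_C_eq_card, Finset.card_fin]
  have hmonic : (∏ j, (X - C (Complex.I * (η j : ℂ)))).Monic := monic_prod_X_sub_C _ _
  have hQdeg : Q.natDegree ≤ r := by
    have := degree_partialNumerator_lt Finset.univ (fun p => (d p : ℂ))
      (fun p => Complex.I * (μ p : ℂ))
    rw [Finset.card_fin] at this
    exact natDegree_le_iff_coeff_eq_zero.2 fun N hN => (degree_lt_iff_coeff_zero _ _).1 this N hN
  have hQeq := eq_leadingCoeff_mul_of_monic_of_dvd_of_natDegree_le hmonic hdvd (hQdeg.trans hdeg.ge)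
  have hlead : Q.leadingCoeff = ((∑ p, d p : ℝ) : ℂ) := by
    have h1 := coeff_partialNumerator (s := Finset.univ) (fun p => (d p : ℂ))
      (fun p => Complex.I * (μ p : ℂ)) (r := r) (by simp)
    rw [← hQ, hQeq, coeff_C_mul] at h1
    have h2 := hmonic.coeff_natDegree
    rw [hdeg] at h2
    rw [h2, mul_one] at h1
    rw [h1]
    push_cast
    rfl
  rw [hlead] at hQeq
  refine ⟨_, ⟨μ, η, hη, hsymm, fun j => ?_, rfl, rfl⟩, hQeq⟩
  have hpos : 0 < ∑ p, d p := Finset.sum_pos (fun p _ => hd p) Finset.univ_nonempty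
  -- Symmetry of nodes and weights makes the real numerator even or odd, so reflecting a zero gives
  -- a zero.
  have hreflect : ∑ p, d p * ∏ q ∈ Finset.univ.erase p, (-η j.rev - μ q) = 0 := by
    have h1 : ∑ p, d p * ∏ q ∈ Finset.univ.erase p, (-η j.rev - μ q) =
        (-1) ^ r * ∑ p, d p * ∏ q ∈ Finset.univ.erase p, (η j.rev - μ q) := by
      rw [← Equiv.sum_comp Fin.revPerm, Finset.mul_sum]
      refine Finset.sum_congr rfl fun p _ => ?_
      have hc : (-1 : ℝ) ^ r = ∏ _q ∈ Finset.univ.erase p, (-1 : ℝ) := by simp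
      rw [Fin.revPerm_apply, hdsymm, prod_erase_rev, mul_left_comm]
      congr 1
      rw [hc, ← Finset.prod_mul_distrib]
      refine Finset.prod_congr rfl fun q _ => ?_
      rw [hsymm q]; ring
    rw [h1, hroot, mul_zero]
  have heval : Q.eval (Complex.I * ((-η j.rev : ℝ) : ℂ)) = 0 := by
    rw [hIeval, hreflect]; simp
  rw [hQeq, eval_mul, eval_C, mul_eq_zero, or_iff_right (by exact_mod_cast hpos.ne'), eval_prod,
    Finset.prod_eq_zero_iff] at heval
  obtain ⟨i, -, hi⟩ := heval
  rw [eval_sub, eval_X, eval_C, sub_eq_zero] at hi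
  have hi' : -η j.rev = η i := I_mul_ofReal_injective hi
  have h1 := hη j.rev
  have h2 := hη i
  rw [← hi'] at h2
  rw [← Fin.rev_succ, ← Fin.rev_castSucc] at h1
  have h3 := hsymm j.succ
  have h4 := hsymm j.castSucc
  -- The reflected zero `-η j.rev = η i` lies in the gap after node `i` and in the gap after node
  -- `j`, so these gaps coincide.
  have h5 : i.castSucc < j.succ := hμ.lt_iff_lt.1 (by linarith)
  have h6 : j.castSucc < i.succ := hμ.lt_iff_lt.1 (by linarith)
  have : i = j := by
    simp only [Fin.lt_def, Fin.val_castSucc, Fin.val_succ] at h5 h6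
    ext; omega
  rw [← this] at hi' ⊢
  exact hi'.symm

theorem isInterlacingPair_of_weights_finset {k : ℕ} {m w : Fin k → ℝ} (hm : StrictMono m)
    (hsymm : ∀ j, m j = -m j.rev) (hw : ∀ p, 0 < w p) (hwsymm : ∀ p, w p.rev = w p)
    {s : Finset (Fin k)} (hs : ∀ p ∈ s, p.rev ∈ s) (hcard : s.card = r + 1) :
    ∃ h, IsInterlacingPair r (∏ p ∈ s, (X - C (Complex.I * (m p : ℂ)))) h ∧
      partialNumerator s (fun p => (w p : ℂ)) (fun p => Complex.I * (m p : ℂ)) =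
        C ((∑ p ∈ s, w p : ℝ) : ℂ) * h := by
  set e := s.orderEmbOfFin hcard with he
  have hes : ∀ a, e a ∈ s := s.orderEmbOfFin_mem hcard
  have hrev : ∀ a, e a.rev = (e a).rev := by
    -- Reversing both the index and the value gives another increasing enumeration of the invariant
    -- set `s`; enumerations being unique, `e` commutes with reversal.
    have := Finset.orderEmbOfFin_unique hcard (f := fun a => (e a.rev).rev)
      (fun a => hs _ (hes _)) (fun a b hab => by simpa using hab)
    intro a
    rw [← he] at this
    rw [← congrFun this a, Fin.rev_rev]
  have himg : s = Finset.univ.map e.toEmbedding := by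
    ext x
    have := Finset.range_orderEmbOfFin s hcard
    rw [← Finset.mem_coe, ← this]
    simp [he]
  obtain ⟨h, h1, h2⟩ := isInterlacingPair_of_weights (μ := m ∘ e) (d := w ∘ e)
    (hm.comp e.strictMono) (fun j => by simp only [Function.comp_apply, hrev]; exact hsymm _)
    (fun p => hw _) (fun p => by simp only [Function.comp_apply, hrev]; exact hwsymm _)
  refine ⟨h, ?_, ?_⟩
  · rw [himg, Finset.prod_map]
    exact h1
  · rw [himg, Finset.sum_map]
    refine Eq.trans ?_ h2
    rw [partialNumerator, partialNumerator, Finset.sum_map]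
    refine Finset.sum_congr rfl fun p _ => ?_
    rw [← Finset.map_erase, Finset.prod_map]
    rfl

end InterlacingPairs

/-! ### Factorizations as colourings, and uniqueness of partial fractions. -/

section Factorizations

variable {ι α K : Type*} [Fintype ι] [DecidableEq α] [Field K]

theorem prod_fibers_eq {N : Finset α} {c : ι → α} (hc : ∀ p, c p ∈ N) (a : ι → K) :
    ∏ j ∈ N, ∏ p with c p = j, (X - C (a p)) = ∏ p, (X - C (a p)) :=
  Finset.prod_fiberwise_of_maps_to (fun p _ => hc p) _

theorem partialNumerator_eq_sum_fibers [DecidableEq ι] {N : Finset α} {c : ι → α} (hc : ∀ p, c p ∈ N)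
    (d a : ι → K) :
    partialNumerator Finset.univ d a = ∑ j ∈ N,
      partialNumerator (Finset.univ.filter fun p => c p = j) d a *
        ∏ i ∈ N.erase j, ∏ q with c q = i, (X - C (a q)) := by
  rw [partialNumerator, ← Finset.sum_fiberwise_of_maps_to (fun p _ => hc p)]
  refine Finset.sum_congr rfl fun j hj => ?_
  rw [partialNumerator, Finset.sum_mul]
  refine Finset.sum_congr rfl fun p hp => ?_
  have hpj : c p = j := (Finset.mem_filter.1 hp).2
  rw [mul_assoc]
  congr 1
  rw [← Finset.prod_fiberwise_of_maps_to (g := c) (t := N) (fun p _ => hc p),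
    ← Finset.mul_prod_erase N _ hj]
  congr 1
  · refine Finset.prod_congr ?_ fun _ _ => rfl
    ext q
    simp only [Finset.mem_filter, Finset.mem_erase, Finset.mem_univ, and_true, true_and]
  · refine Finset.prod_congr rfl fun i hi => Finset.prod_congr ?_ fun _ _ => rfl
    ext q
    simp only [Finset.mem_filter, Finset.mem_erase, Finset.mem_univ, and_true, true_and,
      and_iff_right_iff_imp]
    rintro rfl rfl
    exact Finset.ne_of_mem_erase hi hpj

/-- Colour each root by a factor vanishing there. The class products divide the factors, and
equality of the total degrees leaves no room for a proper divisor. -/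
theorem exists_colouring_of_prod_eq {N : Finset α} {a : ι → K} (ha : Function.Injective a)
    {gs : α → K[X]} (hmonic : ∀ j ∈ N, (gs j).Monic)
    (hprod : ∏ j ∈ N, gs j = ∏ p, (X - C (a p))) :
    ∃ c : ι → α, (∀ p, c p ∈ N) ∧ ∀ j ∈ N, gs j = ∏ p with c p = j, (X - C (a p)) := by
  have hroot : ∀ p, ∃ j ∈ N, (gs j).eval (a p) = 0 := fun p => by
    rw [← Finset.prod_eq_zero_iff, ← eval_prod, hprod, eval_prod]
    exact Finset.prod_eq_zero (Finset.mem_univ p) (by simp)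
  choose c hcN hc using hroot
  have hdvd : ∀ j, ∏ p with c p = j, (X - C (a p)) ∣ gs j := fun j =>
    prod_X_sub_C_dvd_of_eval_eq_zero ha.injOn fun p hp => (Finset.mem_filter.1 hp).2 ▸ hc p
  have hle : ∀ j ∈ N, (∏ p with c p = j, (X - C (a p))).natDegree ≤ (gs j).natDegree :=
    fun j hj => natDegree_le_of_dvd (hdvd j) (hmonic j hj).ne_zero
  have hsum : ∑ j ∈ N, (∏ p with c p = j, (X - C (a p))).natDegree =
      ∑ j ∈ N, (gs j).natDegree := by
    rw [← natDegree_prod_of_monic _ _ hmonic,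
      ← natDegree_prod_of_monic _ _ fun j _ => monic_prod_X_sub_C _ _, prod_fibers_eq hcN, hprod]
  refine ⟨c, hcN, fun j hj => ?_⟩
  exact eq_of_monic_of_dvd_of_natDegree_le (monic_prod_X_sub_C _ _) (hmonic j hj) (hdvd j)
    ((Finset.sum_eq_sum_iff_of_le hle).1 hsum j hj).ge

/-- At a node of colour `j` every summand but the `j`-th vanishes and its cofactor does not. So `P
j` and `Q j` agree at as many nodes as their degree bound. -/
theorem eq_of_sum_mul_prod_fibers_eq {N : Finset α} {a : ι → K} (ha : Function.Injective a)
    {c : ι → α} {P Q : α → K[X]}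
    (hP : ∀ j ∈ N, (P j).degree < (Finset.univ.filter fun p => c p = j).card)
    (hQ : ∀ j ∈ N, (Q j).degree < (Finset.univ.filter fun p => c p = j).card)
    (h : ∑ j ∈ N, P j * ∏ i ∈ N.erase j, ∏ q with c q = i, (X - C (a q)) =
      ∑ j ∈ N, Q j * ∏ i ∈ N.erase j, ∏ q with c q = i, (X - C (a q))) :
    ∀ j ∈ N, P j = Q j := by
  intro j hj
  refine eq_of_degrees_lt_of_eval_index_eq _ ha.injOn (hP j hj) (hQ j hj) fun p hp => ?_
  have hpj : c p = j := (Finset.mem_filter.1 hp).2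
  have key : ∀ R : α → K[X],
      (∑ j ∈ N, R j * ∏ i ∈ N.erase j, ∏ q with c q = i, (X - C (a q))).eval (a p) =
        (R j).eval (a p) * ∏ i ∈ N.erase j, ∏ q with c q = i, (a p - a q) := by
    intro R
    rw [eval_finsetSum, Finset.sum_eq_single_of_mem j hj]
    · simp [eval_prod]
    · intro i _ hij
      rw [eval_mul, eval_prod, Finset.prod_eq_zero (Finset.mem_erase.2 ⟨hij.symm, hj⟩), mul_zero]
      rw [eval_prod]
      exact Finset.prod_eq_zero hp (by simp)
  have h' := congrArg (eval (a p)) h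
  rw [key, key] at h'
  refine mul_right_cancel₀ (Finset.prod_ne_zero_iff.2 fun i hi =>
    Finset.prod_ne_zero_iff.2 fun q hq => sub_ne_zero.2 fun hpq => ?_) h'
  rw [← ha hpq] at hq
  exact Finset.ne_of_mem_erase hi ((Finset.mem_filter.1 hq).2.symm.trans hpj)

end Factorizations

/-! ### Decomposing an interlacing pair over the branches. -/

section Decompositions

variable {α : Type*} [DecidableEq α] {N : Finset α} {k : ℕ} {f g : ℂ[X]}

theorem IsInterlacingPair.exists_decomposition (hfg : IsInterlacingPair k f g) {n : α → ℕ}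
    (hn : ∑ j ∈ N, n j = k) (hpos : ∀ j ∈ N, 0 < n j)
    (hodd : ∀ i ∈ N, ∀ j ∈ N, Odd (n i) → Odd (n j) → i = j) :
    ∃ (gs hs : α → ℂ[X]) (y : α → ℝ),
      (∀ j ∈ N, IsInterlacingPair (n j - 1) (gs j) (hs j)) ∧ g = ∏ j ∈ N, gs j ∧
      f = X * g + ∑ j ∈ N, C (y j : ℂ) * hs j * ∏ i ∈ N.erase j, gs i := by
  obtain ⟨l, m, hint, hl, hm, rfl, rfl⟩ := hfg
  obtain ⟨d, hd, hdsymm, hfd⟩ := exists_partialNumerator_of_interlaces hint hl hm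
  obtain ⟨c, hcN, hcrev, hcard⟩ := exists_rev_invariant_colouring N k n hn hodd
  have key : ∀ j ∈ N, ∃ h, IsInterlacingPair (n j - 1)
      (∏ p with c p = j, (X - C (Complex.I * (m p : ℂ)))) h ∧
      partialNumerator (Finset.univ.filter fun p => c p = j) (fun p => (d p : ℂ))
        (fun p => Complex.I * (m p : ℂ)) = C ((∑ p with c p = j, d p : ℝ) : ℂ) * h := fun j hj =>
    isInterlacingPair_of_weights_finset (strictMono_of_interlaces hint).2 hm hd hdsymm
      (fun p hp => by simpa [hcrev] using hp)
      (by rw [hcard j hj, Nat.sub_add_cancel (hpos j hj)])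
  choose! hs hpair hnum using key
  refine ⟨fun j => ∏ p with c p = j, (X - C (Complex.I * (m p : ℂ))), hs,
    fun j => ∑ p with c p = j, d p, hpair, (prod_fibers_eq hcN _).symm, ?_⟩
  refine hfd.trans (congrArg _ ((partialNumerator_eq_sum_fibers hcN _ _).trans ?_))
  exact Finset.sum_congr rfl fun j hj => congrArg (· * _) (hnum j hj)

/-- No choice in the construction can go wrong: closure of the roots under conjugation makes the
colour classes reversal-invariant, and uniqueness of partial fractions identifies `y j` and `hs j`.
Parities play no role here. -/
theorem IsInterlacingPair.of_decomposition (hfg : IsInterlacingPair k f g) {gs hs : α → ℂ[X]}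
    {y : α → ℝ} (hgs_monic : ∀ j ∈ N, (gs j).Monic) (hgs_deg : ∀ j ∈ N, 0 < (gs j).natDegree)
    (hgs_roots : ∀ j ∈ N, ∀ z ∈ (gs j).roots, (starRingEnd ℂ) z ∈ (gs j).roots)
    (hg : g = ∏ j ∈ N, gs j) (hhs_monic : ∀ j ∈ N, (hs j).Monic)
    (hhs_deg : ∀ j ∈ N, (hs j).degree < (gs j).degree)
    (hf : f = X * g + ∑ j ∈ N, C (y j : ℂ) * hs j * ∏ i ∈ N.erase j, gs i) :
    ∀ j ∈ N, 0 < y j ∧ IsInterlacingPair ((gs j).natDegree - 1) (gs j) (hs j) := by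
  obtain ⟨l, m, hint, hl, hm, rfl, rfl⟩ := hfg
  obtain ⟨d, hd, hdsymm, hfd⟩ := exists_partialNumerator_of_interlaces hint hl hm
  have hmono := (strictMono_of_interlaces hint).2
  have ha : Function.Injective fun p => Complex.I * (m p : ℂ) :=
    I_mul_ofReal_injective.comp hmono.injective
  obtain ⟨c, hcN, hgs⟩ := exists_colouring_of_prod_eq ha hgs_monic hg.symm
  have hcard : ∀ j ∈ N, (gs j).natDegree = (Finset.univ.filter fun p => c p = j).card :=
    fun j hj => by rw [hgs j hj, natDegree_finsetProd_X_sub_C_eq_card]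
  have hnum := eq_of_sum_mul_prod_fibers_eq (N := N) ha (c := c)
    (P := fun j => C (y j : ℂ) * hs j) (Q := fun j => partialNumerator
      (Finset.univ.filter fun p => c p = j) (fun p => (d p : ℂ)) (fun p => Complex.I * (m p : ℂ)))
    (fun j hj => by
      have h0 : (C (y j : ℂ)).degree ≤ 0 := degree_C_le
      refine (degree_mul_le_of_le h0 le_rfl).trans_lt ?_
      rw [zero_add, ← hcard j hj, ← degree_eq_natDegree (hgs_monic j hj).ne_zero]
      exact hhs_deg j hj)
    (fun j _ => degree_partialNumerator_lt _ _ _) (by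
      rw [← partialNumerator_eq_sum_fibers hcN, ← add_left_cancel (hf.symm.trans hfd)]
      refine Finset.sum_congr rfl fun j _ => ?_
      congr 1
      exact Finset.prod_congr rfl fun i hi => (hgs i (Finset.mem_of_mem_erase hi)).symm)
  intro j hj
  have hroot : ∀ p, c p = j ↔ Complex.I * (m p : ℂ) ∈ (gs j).roots := fun p => by
    rw [mem_roots (hgs_monic j hj).ne_zero, IsRoot, hgs j hj, eval_prod, Finset.prod_eq_zero_iff]
    simp only [Finset.mem_filter, Finset.mem_univ, true_and, eval_sub, eval_X, eval_C, sub_eq_zero]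
    exact ⟨fun h => ⟨p, h, rfl⟩, fun ⟨q, hq, h⟩ => ha h ▸ hq⟩
  have hrev : ∀ p ∈ Finset.univ.filter (fun p => c p = j),
      p.rev ∈ Finset.univ.filter (fun p => c p = j) := by
    intro p hp
    simp only [Finset.mem_filter, Finset.mem_univ, true_and, hroot] at hp ⊢
    have := hgs_roots j hj _ hp
    rw [map_mul, Complex.conj_I, Complex.conj_ofReal, hm p] at this
    simpa using this
  obtain ⟨h, hpair, hnum'⟩ := isInterlacingPair_of_weights_finset (r := (gs j).natDegree - 1)
    hmono hm hd hdsymm hrev (by rw [← hcard j hj, Nat.sub_add_cancel (hgs_deg j hj)])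
  have hne : (Finset.univ.filter fun p => c p = j).Nonempty := by
    rw [← Finset.card_pos, ← hcard j hj]
    exact hgs_deg j hj
  have hpos : 0 < ∑ p with c p = j, d p := Finset.sum_pos (fun p _ => hd p) hne
  have hh : h.Monic := by
    obtain ⟨_, m', -, -, -, -, rfl⟩ := hpair
    exact monic_prod_X_sub_C _ _
  have heq : C (y j : ℂ) * hs j = C ((∑ p with c p = j, d p : ℝ) : ℂ) * h :=
    (hnum j hj).trans hnum'
  -- Both `hs j` and `h` are monic, so leading coefficients compare the constants.
  have hy : y j = ∑ p with c p = j, d p := by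
    have := congrArg leadingCoeff heq
    rw [leadingCoeff_mul_monic (hhs_monic j hj), leadingCoeff_mul_monic hh, leadingCoeff_C,
      leadingCoeff_C] at this
    exact_mod_cast this
  rw [hy] at heq ⊢
  have hhs : hs j = h :=
    mul_left_cancel₀ (C_ne_zero.2 (by exact_mod_cast hpos.ne')) heq
  rw [← hgs j hj] at hpair
  exact ⟨hpos, hhs ▸ hpair⟩

end Decompositions

/-! ### Assembling a skew-symmetric matrix from its branches. -/

section MatrixGraphs

variable {V : Type u}

theorem matrixGraph_adj {A : Matrix V V ℝ} (hA : A.transpose = -A) {a b : V} :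
    (matrixGraph A).Adj a b ↔ A a b ≠ 0 := by
  have hs : ∀ a b, A b a = -A a b := fun a b => congrFun (congrFun hA a) b
  rw [matrixGraph, SimpleGraph.fromRel_adj]
  constructor
  · rintro ⟨-, h | h⟩
    · exact h
    · rw [hs] at h
      exact neg_ne_zero.1 h
  · refine fun h => ⟨?_, Or.inl h⟩
    rintro rfl
    have := hs a a
    exact h (by linarith)

theorem matrixGraph_principalSub (A : Matrix V V ℝ) (s : Set V) :
    matrixGraph (principalSub A s) = (matrixGraph A).induce s := by
  ext a b
  simp [matrixGraph, principalSub, Subtype.ext_iff]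

variable {T : SimpleGraph V} {v : V} {A : Matrix V V ℝ}

theorem transpose_eq_neg_of_branches
    (hroot : ∀ j, T.Adj v j → A j v = -A v j)
    (hbranch : ∀ j, T.Adj v j → (principalSub A (treeBranch T v j)).transpose =
      -principalSub A (treeBranch T v j))
    (hroot_zero : ∀ a, ¬ T.Adj v a → A v a = 0 ∧ A a v = 0)
    (hzero : ∀ a b, a ≠ v → b ≠ v →
      (∀ j, T.Adj v j → ¬ (a ∈ treeBranch T v j ∧ b ∈ treeBranch T v j)) → A a b = 0) :
    A.transpose = -A := by
  have hv : ∀ a, A a v = -A v a := fun a => by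
    by_cases ha : T.Adj v a
    · exact hroot a ha
    · simp [hroot_zero a ha]
  ext a b
  rw [Matrix.transpose_apply, Matrix.neg_apply]
  by_cases ha : a = v
  · subst ha; exact hv b
  by_cases hb : b = v
  · subst hb; rw [hv a, neg_neg]
  by_cases h : ∃ j, T.Adj v j ∧ (a ∈ treeBranch T v j ∧ b ∈ treeBranch T v j)
  · obtain ⟨j, hj, ha', hb'⟩ := h
    exact congrFun (congrFun (hbranch j hj) ⟨a, ha'⟩) ⟨b, hb'⟩
  · push Not at h
    rw [hzero a b ha hb fun j hj h' => h j hj h'.1 h'.2,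
      hzero b a hb ha fun j hj h' => h j hj h'.2 h'.1, neg_zero]

theorem matrixGraph_eq_of_branches (hT : T.IsTree) (hA : A.transpose = -A)
    (hroot : ∀ j, T.Adj v j → A v j ≠ 0)
    (hbranch : ∀ j, T.Adj v j → matrixGraph (principalSub A (treeBranch T v j)) =
      T.induce (treeBranch T v j))
    (hroot_zero : ∀ a, ¬ T.Adj v a → A v a = 0)
    (hzero : ∀ a b, a ≠ v → b ≠ v →
      (∀ j, T.Adj v j → ¬ (a ∈ treeBranch T v j ∧ b ∈ treeBranch T v j)) → A a b = 0) :
    matrixGraph A = T := by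
  have hv : ∀ a, A v a ≠ 0 ↔ T.Adj v a := fun a =>
    ⟨fun h => by_contra fun h' => h (hroot_zero a h'), hroot a⟩
  ext a b
  by_cases ha : a = v
  · subst ha; rw [matrixGraph_adj hA, hv]
  by_cases hb : b = v
  · subst hb; rw [SimpleGraph.adj_comm, matrixGraph_adj hA, hv, SimpleGraph.adj_comm]
  by_cases h : ∃ j, T.Adj v j ∧ (a ∈ treeBranch T v j ∧ b ∈ treeBranch T v j)
  · obtain ⟨j, hj, ha', hb'⟩ := h
    have := hbranch j hj
    rw [matrixGraph_principalSub] at this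
    have h2 := congrArg (fun G => G.Adj ⟨a, ha'⟩ ⟨b, hb'⟩) this
    simpa using h2
  · push Not at h
    rw [matrixGraph_adj hA, hzero a b ha hb fun j hj h' => h j hj h'.1 h'.2]
    refine ⟨fun h0 => absurd rfl h0, fun hab => ?_⟩
    obtain ⟨j, hj, haj⟩ := exists_adj_mem_treeBranch hT.connected ha
    exact absurd (mem_treeBranch_of_adj haj hab hb) (h j hj haj)

theorem exists_matrix_with_branches (hT : T.IsAcyclic) (y : V → ℝ)
    (B : ∀ j, T.Adj v j → Matrix (treeBranch T v j) (treeBranch T v j) ℝ) :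
    ∃ A : Matrix V V ℝ, (∀ j, T.Adj v j → A v j = √(y j) ∧ A j v = -√(y j)) ∧
      (∀ j (h : T.Adj v j), principalSub A (treeBranch T v j) = B j h) ∧
      (∀ a, ¬ T.Adj v a → A v a = 0 ∧ A a v = 0) ∧
      ∀ a b, a ≠ v → b ≠ v →
        (∀ j, T.Adj v j → ¬ (a ∈ treeBranch T v j ∧ b ∈ treeBranch T v j)) → A a b = 0 := by
  classical
  let A : Matrix V V ℝ := Matrix.of fun a b =>
    if a = v then (if T.Adj v b then √(y b) else 0)
    else if b = v then (if T.Adj v a then -√(y a) else 0)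
    else if h : ∃ j, T.Adj v j ∧ (a ∈ treeBranch T v j ∧ b ∈ treeBranch T v j) then
      B h.choose h.choose_spec.1 ⟨a, h.choose_spec.2.1⟩ ⟨b, h.choose_spec.2.2⟩
    else 0
  refine ⟨A, fun j hj => ?_, fun j hj => ?_, fun a ha => ?_, fun a b ha hb hab => ?_⟩
  · simp [A, hj, hj.ne']
  · ext a b
    have h : ∃ j, T.Adj v j ∧ (a.1 ∈ treeBranch T v j ∧ b.1 ∈ treeBranch T v j) :=
      ⟨j, hj, a.2, b.2⟩
    have h1 : A a b = B h.choose h.choose_spec.1 ⟨a, h.choose_spec.2.1⟩ ⟨b, h.choose_spec.2.2⟩ := by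
      simp only [A, Matrix.of_apply, if_neg (ne_of_mem_treeBranch a.2),
        if_neg (ne_of_mem_treeBranch b.2)]
      exact dif_pos h
    refine h1.trans ?_
    -- The branch picked by `choose` is the intended one because branches are disjoint; stating this
    -- for general `i` allows substitution in the dependent types.
    have h2 : ∀ i (hi : T.Adj v i) (ha : a.1 ∈ treeBranch T v i) (hb : b.1 ∈ treeBranch T v i),
        i = j → B i hi ⟨a, ha⟩ ⟨b, hb⟩ = B j hj a b := by
      rintro i hi ha hb rfl
      rfl
    exact h2 _ _ _ _ (eq_of_mem_treeBranch hT h.choose_spec.1 hj h.choose_spec.2.1 a.2)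
  · simp [A, ha]
  · simp only [A, Matrix.of_apply, if_neg ha, if_neg hb]
    exact dif_neg fun ⟨j, hj, h⟩ => hab j hj h

end MatrixGraphs

/-! ### What a constructed matrix has to satisfy. -/

section Realizations

open Classical in
/-- `A` has graph `T`, characteristic polynomial `f`, deleting `v` leaves the characteristic
polynomial `g`, and `A` has the Duarte property with respect to `v`. -/
structure Realizes {V : Type u} [Fintype V] (T : SimpleGraph V) (v : V) (f g : ℂ[X])
    (A : Matrix V V ℝ) : Prop where
  transpose_eq : A.transpose = -A
  graph_eq : matrixGraph A = T
  charpoly_eq : (A.map Complex.ofReal).charpoly = f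
  charpoly_sub_eq : ((principalSub A ({v}ᶜ : Set V)).map Complex.ofReal).charpoly = g
  hasDuarte : HasDuarte A v

theorem roots_prod_X_sub_C_univ {ι : Type*} [Fintype ι] (a : ι → ℂ) :
    (∏ j, (X - C (a j))).roots = Finset.univ.val.map a := by
  have := roots_multiset_prod_X_sub_C (Finset.univ.val.map a)
  rwa [Multiset.map_map] at this

theorem strictlyInterlaces_roots {k : ℕ} {f g : ℂ[X]} (h : IsInterlacingPair k f g) :
    StrictlyInterlaces g.roots f.roots := by
  obtain ⟨l, m, hint, -, -, rfl, rfl⟩ := h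
  exact ⟨k, l, m, roots_prod_X_sub_C_univ _, roots_prod_X_sub_C_univ _, hint⟩

end Realizations

/-! ### Base cases with one and two vertices. -/

section Construction

/-- Replaces the classical equality test inside `matrixEigs` by an arbitrary one. -/
theorem matrixEigs_eq_roots_charpoly {V : Type u} [Fintype V] [DecidableEq V] (A : Matrix V V ℝ) :
    matrixEigs A = (A.map Complex.ofReal).charpoly.roots := by
  unfold matrixEigs
  congr!

theorem IsInterlacingPair.monic_left {k : ℕ} {f g : ℂ[X]} (h : IsInterlacingPair k f g) :
    f.Monic := by
  obtain ⟨l, m, -, -, -, rfl, rfl⟩ := h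
  exact monic_prod_X_sub_C _ _

theorem IsInterlacingPair.monic_right {k : ℕ} {f g : ℂ[X]} (h : IsInterlacingPair k f g) :
    g.Monic := by
  obtain ⟨l, m, -, -, -, rfl, rfl⟩ := h
  exact monic_prod_X_sub_C _ _

theorem IsInterlacingPair.natDegree_left {k : ℕ} {f g : ℂ[X]} (h : IsInterlacingPair k f g) :
    f.natDegree = k + 1 := by
  obtain ⟨l, m, -, -, -, rfl, rfl⟩ := h
  rw [natDegree_finsetProd_X_sub_C_eq_card, Finset.card_fin]

theorem IsInterlacingPair.degree_lt {k : ℕ} {f g : ℂ[X]} (h : IsInterlacingPair k f g) :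
    g.degree < f.degree := by
  rw [degree_eq_natDegree h.monic_left.ne_zero, h.natDegree_left]
  obtain ⟨l, m, -, -, -, rfl, rfl⟩ := h
  rw [degree_eq_natDegree (monic_prod_X_sub_C _ _).ne_zero,
    natDegree_finsetProd_X_sub_C_eq_card, Finset.card_fin]
  exact_mod_cast Nat.lt_succ_self k

theorem IsInterlacingPair.roots_left {k : ℕ} {f g : ℂ[X]} (h : IsInterlacingPair k f g) :
    ∀ z ∈ f.roots, z.re = 0 ∧ (starRingEnd ℂ) z ∈ f.roots := by
  obtain ⟨l, m, -, hl, -, rfl, rfl⟩ := h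
  rw [roots_prod_X_sub_C_univ]
  intro z hz
  obtain ⟨j, -, rfl⟩ := Multiset.mem_map.1 hz
  refine ⟨by simp, Multiset.mem_map.2 ⟨j.rev, Finset.mem_univ_val _, ?_⟩⟩
  rw [map_mul, Complex.conj_I, Complex.conj_ofReal, hl j]
  simp

variable {V : Type u} [Fintype V] {T : SimpleGraph V} {v : V} {f g : ℂ[X]} {k : ℕ}
  {A : Matrix V V ℝ}

open Classical in
theorem hasDuarte_of_charpoly_eq (hT : T.IsTree) (hG : matrixGraph A = T)
    (hn : 1 < Fintype.card V) (hfg : IsInterlacingPair k f g)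
    (hf : (A.map Complex.ofReal).charpoly = f)
    (hg : ((principalSub A ({v}ᶜ : Set V)).map Complex.ofReal).charpoly = g)
    (hb : ∀ (j : V) (h : T.Adj v j), HasDuarte (principalSub A (treeBranch T v j))
      ⟨j, mem_treeBranch_self T h⟩) : HasDuarte A v := by
  subst hG
  refine HasDuarte.step A v hT hn ?_ hb
  rw [matrixEigs_eq_roots_charpoly, matrixEigs_eq_roots_charpoly, hf, hg]
  exact strictlyInterlaces_roots hfg

theorem eq_X_and_eq_one_of_isInterlacingPair_zero (h : IsInterlacingPair 0 f g) :
    f = X ∧ g = 1 := by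
  obtain ⟨l, m, -, hl, -, rfl, rfl⟩ := h
  have h0 := hl 0
  have : l 0 = 0 := by
    rw [show (0 : Fin (0 + 1)).rev = 0 from rfl] at h0
    linarith
  simp [this]

theorem exists_of_isInterlacingPair_one (h : IsInterlacingPair 1 f g) :
    ∃ l : ℝ, l < 0 ∧ f = (X - C (Complex.I * (l : ℂ))) * (X + C (Complex.I * (l : ℂ))) ∧
      g = X := by
  obtain ⟨l, m, hint, hl, hm, rfl, rfl⟩ := h
  have h0 := hm 0
  have h1 := hl 1
  rw [show (0 : Fin 1).rev = 0 from rfl] at h0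
  rw [show (1 : Fin (1 + 1)).rev = 0 from rfl] at h1
  have h2 : m 0 = 0 := by linarith
  have h3 := (hint 0).1
  rw [h2] at h3
  refine ⟨l 0, h3, ?_, ?_⟩
  · rw [Fin.prod_univ_two, h1]
    simp
  · simp [h2]

theorem realizes_of_card_eq_one (hn : Fintype.card V = 1) (hT : T.IsTree) (hf : f = X)
    (hg : g = 1) (hA : A = 0) : Realizes T v f g A := by
  classical
  have hsub := Fintype.card_le_one_iff.1 hn.le
  have hG : matrixGraph A = T := by
    ext a b
    simp [hsub a b]
  refine ⟨by simp [hA], hG, ?_, ?_, HasDuarte.single A v (hG ▸ hT) hn⟩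
  · subst hA
    rw [Matrix.map_zero _ Complex.ofReal_zero, hf]
    convert Matrix.charpoly_zero
    rw [hn, pow_one]
  · rw [hg]
    refine eq_one_of_monic_natDegree_zero (Matrix.charpoly_monic _) ?_
    rw [Matrix.charpoly_natDegree_eq_dim, Fintype.card_eq_zero_iff]
    exact ⟨fun x => x.2 (hsub _ _)⟩

theorem eq_or_eq_of_card_eq_two (hn : Fintype.card V = 2) {p q : V} (hpq : p ≠ q) (x : V) :
    x = p ∨ x = q := by
  classical
  have h : ({p, q} : Finset V) = Finset.univ :=
    (Finset.card_eq_iff_eq_univ _).1 (by rw [Finset.card_pair hpq, hn])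
  have hx := Finset.mem_univ x
  rw [← h] at hx
  simpa using hx

/-- The order of `p` and `q` is immaterial: trace `0` and determinant `l ^ 2` already determine the
characteristic polynomial. -/
theorem realizes_of_card_eq_two (hn : Fintype.card V = 2) (hNEB : IsNEB T v)
    (hfg : IsInterlacingPair 1 f g) {l : ℝ} (hl : l < 0)
    (hf : f = (X - C (Complex.I * (l : ℂ))) * (X + C (Complex.I * (l : ℂ)))) (hg : g = X)
    {p q : V} (hpq : p ≠ q) (hApq : A p q = l) (hAqp : A q p = -l) (hApp : A p p = 0)
    (hAqq : A q q = 0) : Realizes T v f g A := by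
  classical
  have hT := hNEB.isTree
  have hcases := eq_or_eq_of_card_eq_two hn hpq
  have hskew : A.transpose = -A := by
    ext a b
    rcases hcases a with rfl | rfl <;> rcases hcases b with rfl | rfl <;> simp [*]
  have hne : ∀ a b, A a b ≠ 0 ↔ a ≠ b := by
    intro a b
    rcases hcases a with rfl | rfl <;> rcases hcases b with rfl | rfl <;>
      simp [*, hpq.symm, hl.ne]
  have hadj : ∀ a b, T.Adj a b ↔ a ≠ b := by
    refine fun a b => ⟨fun h => h.ne, fun h => ?_⟩
    obtain ⟨j, hj, -⟩ := exists_adj_mem_treeBranch hT.connected (Ne.symm h)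
    rcases eq_or_eq_of_card_eq_two hn h j with rfl | rfl
    · exact absurd rfl hj.ne
    · exact hj
  have hG : matrixGraph A = T := by
    ext a b
    rw [matrixGraph_adj hskew, hne, hadj]
  have hdiag : ∀ a, A a a = 0 := fun a => by_contra fun h => (hne a a).1 h rfl
  have hcf : (A.map Complex.ofReal).charpoly = f := by
    have hdet : (A.map Complex.ofReal).det = (l : ℂ) ^ 2 := by
      have e := Fintype.equivFinOfCardEq hn
      rw [← Matrix.det_submatrix_equiv_self e.symm, Matrix.det_fin_two]
      have hne' : e.symm 0 ≠ e.symm 1 := fun h => by simpa using e.symm.injective h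
      simp only [Matrix.submatrix_apply, Matrix.map_apply, hdiag]
      rcases hcases (e.symm 0) with h0 | h0 <;> rcases hcases (e.symm 1) with h1 | h1
      · exact absurd (h0.trans h1.symm) hne'
      · rw [h0, h1, hApq, hAqp]; push_cast; ring
      · rw [h0, h1, hApq, hAqp]; push_cast; ring
      · exact absurd (h0.trans h1.symm) hne'
    have htr : (A.map Complex.ofReal).trace = 0 := by
      simp [Matrix.trace, hdiag]
    rw [Matrix.charpoly_of_card_eq_two _ hn, hdet, htr, hf]
    have : (C (Complex.I * (l : ℂ))) ^ 2 = -C ((l : ℂ) ^ 2) := by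
      rw [← C_pow, mul_pow, Complex.I_sq, neg_one_mul, C_neg]
    rw [C_0]
    linear_combination this
  have hcg : ((principalSub A ({v}ᶜ : Set V)).map Complex.ofReal).charpoly = g := by
    have hcard : Fintype.card ({v}ᶜ : Set V) = 1 := by
      rw [Fintype.card_compl_set, hn]; simp
    have : Subsingleton ({v}ᶜ : Set V) := Fintype.card_le_one_iff_subsingleton.1 hcard.le
    have hz : (principalSub A ({v}ᶜ : Set V)).map Complex.ofReal = 0 := by
      ext a b
      simp [principalSub, Subsingleton.elim b a, hdiag]
    rw [hz, Matrix.charpoly_zero, hcard, pow_one, hg]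
  refine ⟨hskew, hG, by convert hcf, by convert hcg,
    hasDuarte_of_charpoly_eq hT hG (by omega) hfg (by convert hcf) (by convert hcg) fun j hj => ?_⟩
  refine HasDuarte.single _ _ ?_ ?_
  · rw [matrixGraph_principalSub, hG]
    exact (hNEB.branch hj).isTree
  · refine le_antisymm ?_ (Fintype.card_pos_iff.2 ⟨⟨j, mem_treeBranch_self T hj⟩⟩)
    have := Fintype.card_subtype_lt (p := (· ∈ treeBranch T v j)) (x := v)
      fun h => ne_of_mem_treeBranch h rfl
    rw [hn] at this
    exact Nat.lt_succ_iff.1 (by convert this)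

end Construction

/-! ### The recursive step and the induction. -/

section Recursion

variable {V : Type u} [Fintype V] {T : SimpleGraph V} {v : V} {f g : ℂ[X]} {k : ℕ}
  {A : Matrix V V ℝ}

open Classical in
theorem card_treeBranch_lt (j : V) : Fintype.card (treeBranch T v j) < Fintype.card V :=
  Fintype.card_subtype_lt (p := (· ∈ treeBranch T v j)) (x := v)
    fun h => ne_of_mem_treeBranch h rfl

open Classical in
theorem card_treeBranch_pos {j : V} (hj : T.Adj v j) : 0 < Fintype.card (treeBranch T v j) :=
  Fintype.card_pos_iff.2 ⟨⟨j, mem_treeBranch_self T hj⟩⟩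

open Classical in
theorem exists_isConstructed_of_branches (hNEB : IsNEB T v) (hn : Fintype.card V = k + 1)
    (hk : 2 ≤ k) (hfg : IsInterlacingPair k f g)
    (ih : ∀ (j : V) (h : T.Adj v j) (f g : ℂ[X]),
      IsInterlacingPair (Fintype.card (treeBranch T v j) - 1) f g →
        ∃ B, IsConstructed (T.induce (treeBranch T v j)) ⟨j, mem_treeBranch_self T h⟩ f g B) :
    ∃ A, IsConstructed T v f g A := by
  have hT := hNEB.isTree
  have hcard : ∀ j, (treeBranch T v j).ncard = Fintype.card (treeBranch T v j) := fun j => by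
    rw [← Nat.card_coe_set_eq, Nat.card_eq_fintype_card]
  obtain ⟨gs, hs, y, hpair, hg, hf⟩ := hfg.exists_decomposition (N := T.neighborFinset v)
    (n := fun j => Fintype.card (treeBranch T v j))
    (by have := sum_card_treeBranch (v := v) hT; omega)
    (fun j hj => card_treeBranch_pos ((T.mem_neighborFinset v j).1 hj))
    (fun i hi j hj oi oj => hNEB.eq_of_odd_ncard_treeBranch ((T.mem_neighborFinset v i).1 hi)
      ((T.mem_neighborFinset v j).1 hj) (by rwa [hcard]) (by rwa [hcard]))
  replace hpair := fun j (hj : T.Adj v j) => hpair j ((T.mem_neighborFinset v j).2 hj)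
  choose B hB using fun j (hj : T.Adj v j) => ih j hj _ _ (hpair j hj)
  obtain ⟨A, h1, h2, h3, h4⟩ := exists_matrix_with_branches hT.isAcyclic y B
  refine ⟨A, IsConstructed.step T v f g A (by omega) gs hs y
    (fun j hj => (hpair j hj).monic_left) (fun j hj => ?_)
    (fun j hj => (hpair j hj).roots_left) hg (fun j hj => (hpair j hj).monic_right)
    (fun j hj => (hpair j hj).degree_lt) hf h1 (fun j hj => ?_) h3 h4⟩
  · rw [(hpair j hj).natDegree_left, Nat.sub_add_cancel (card_treeBranch_pos hj)]
  · rw [h2 j hj]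
    exact hB j hj

open Classical in
theorem realizes_of_branches (hT : T.IsTree) (hn : 1 < Fintype.card V)
    (hfg : IsInterlacingPair k f g) {gs hs : V → ℂ[X]} {y : V → ℝ} (hy : ∀ j, T.Adj v j → 0 < y j)
    (hg : g = ∏ j ∈ T.neighborFinset v, gs j)
    (hf : f = X * g + ∑ j ∈ T.neighborFinset v,
      C (y j : ℂ) * hs j * ∏ k ∈ (T.neighborFinset v).erase j, gs k)
    (hroot : ∀ j, T.Adj v j → A v j = √(y j) ∧ A j v = -√(y j))
    (hbranch : ∀ (j : V) (h : T.Adj v j),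
      Realizes (T.induce (treeBranch T v j)) ⟨j, mem_treeBranch_self T h⟩
        (gs j) (hs j) (principalSub A (treeBranch T v j)))
    (hroot_zero : ∀ a, ¬ T.Adj v a → A v a = 0 ∧ A a v = 0)
    (hzero : ∀ a b, a ≠ v → b ≠ v →
      (∀ j, T.Adj v j → ¬ (a ∈ treeBranch T v j ∧ b ∈ treeBranch T v j)) → A a b = 0) :
    Realizes T v f g A := by
  have hskew := transpose_eq_neg_of_branches (fun j hj => by rw [(hroot j hj).1, (hroot j hj).2])
    (fun j hj => (hbranch j hj).transpose_eq) hroot_zero hzero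
  have hG := matrixGraph_eq_of_branches hT hskew
    (fun j hj => by rw [(hroot j hj).1]; exact (Real.sqrt_pos.2 (hy j hj)).ne')
    (fun j hj => (hbranch j hj).graph_eq) (fun a ha => (hroot_zero a ha).1) hzero
  have hmem : ∀ {j}, j ∈ T.neighborFinset v ↔ T.Adj v j := T.mem_neighborFinset v _
  set M := A.map Complex.ofReal with hM
  have hv : ∀ j ∈ T.neighborFinset v, v ∉ treeBranch T v j :=
    fun j _ h => ne_of_mem_treeBranch h rfl
  have hself : ∀ j ∈ T.neighborFinset v, j ∈ treeBranch T v j :=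
    fun j hj => mem_treeBranch_self T (hmem.1 hj)
  have hcover : ∀ x, x ≠ v → ∃ j ∈ T.neighborFinset v, x ∈ treeBranch T v j := fun x hx => by
    obtain ⟨j, hj, h⟩ := exists_adj_mem_treeBranch hT.connected hx
    exact ⟨j, hmem.2 hj, h⟩
  have hdisj : ∀ i ∈ T.neighborFinset v, ∀ j ∈ T.neighborFinset v, ∀ x, x ∈ treeBranch T v i →
      x ∈ treeBranch T v j → i = j := fun i hi j hj x hxi hxj =>
    eq_of_mem_treeBranch hT.isAcyclic (hmem.1 hi) (hmem.1 hj) hxi hxj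
  have hblock : ∀ i ∈ T.neighborFinset v, ∀ j ∈ T.neighborFinset v, i ≠ j →
      ∀ a ∈ treeBranch T v i, ∀ b ∈ treeBranch T v j, M a b = 0 := by
    intro i hi j hj hij a ha b hb
    have : A a b = 0 := hzero a b (ne_of_mem_treeBranch ha) (ne_of_mem_treeBranch hb)
      fun x hx h => hij ((hdisj i hi x (hmem.2 hx) a ha h.1).trans
        (hdisj j hj x (hmem.2 hx) b hb h.2).symm)
    rw [hM, Matrix.map_apply, this, Complex.ofReal_zero]
  have hgs : ∀ j ∈ T.neighborFinset v, (M.submatrix (Subtype.val : treeBranch T v j → V)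
      (Subtype.val : treeBranch T v j → V)).charpoly = gs j := fun j hj => by
    rw [← (hbranch j (hmem.1 hj)).charpoly_eq]
    congr!
  have hcg : ((principalSub A ({v}ᶜ : Set V)).map Complex.ofReal).charpoly = g := by
    have := charpoly_submatrix_compl_singleton_eq_prod hv hself hcover hdisj M hblock
    rw [Finset.prod_congr rfl hgs, ← hg] at this
    exact this
  have hcf : M.charpoly = f := by
    rw [charpoly_eq_of_bordered_blocks hv hself hcover hdisj M hblock
      (fun a ha => by simp [hM, (hroot_zero a fun h => ha (hmem.2 h)).1])
      (fun a ha => by simp [hM, (hroot_zero a fun h => ha (hmem.2 h)).2]) gs hs hgs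
      (fun j hj => by
        rw [← (hbranch j (hmem.1 hj)).charpoly_sub_eq]
        congr!), hf, hg, sub_eq_add_neg, ← Finset.sum_neg_distrib]
    congr 1
    refine Finset.sum_congr rfl fun j hj => ?_
    have hyj := hy j (hmem.1 hj)
    -- Skew-symmetry supplies the sign that turns the difference in the bordered formula into the
    -- sum in `hf`; `y j ≥ 0` is needed for the square root to square back.
    have h1 : M v j * M j v = -(y j : ℂ) := by
      rw [hM, Matrix.map_apply, Matrix.map_apply, (hroot j (hmem.1 hj)).1,
        (hroot j (hmem.1 hj)).2, ← Complex.ofReal_mul, mul_neg, Real.mul_self_sqrt hyj.le,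
        Complex.ofReal_neg]
    rw [h1, C_neg]
    ring
  exact ⟨hskew, hG, hcf, hcg, hasDuarte_of_charpoly_eq hT hG hn hfg hcf hcg
    fun j hj => (hbranch j hj).hasDuarte⟩

/-- Strong induction over all rooted trees and interlacing pairs at once, since a branch has its own
vertex type and receives the pair `(g_j, h_j)`. -/
theorem exists_isConstructed_and_forall_realizes : ∀ (k : ℕ) {V : Type u} [Fintype V]
    (T : SimpleGraph V) (v : V) (f g : ℂ[X]), Fintype.card V = k + 1 → IsNEB T v →
    IsInterlacingPair k f g →
    (∃ A, IsConstructed T v f g A) ∧ ∀ A, IsConstructed T v f g A → Realizes T v f g A := by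
  classical
  intro k
  induction k using Nat.strong_induction_on with
  | _ k ih =>
    intro V _ T v f g hn hNEB hfg
    have hT := hNEB.isTree
    rcases Nat.lt_trichotomy k 1 with hk | rfl | hk
    · obtain rfl : k = 0 := by omega
      obtain ⟨hf, hg⟩ := eq_X_and_eq_one_of_isInterlacingPair_zero hfg
      refine ⟨⟨0, IsConstructed.one T v f g 0 hn hf hg rfl⟩, fun A hA => ?_⟩
      cases hA with
      | one _ _ _ _ _ _ _ _ hA => exact realizes_of_card_eq_one hn hT hf hg hA
      | two _ _ _ _ _ hn' => omega
      | step _ _ _ _ _ hn' => omega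
    · obtain ⟨l, hl, hf, hg⟩ := exists_of_isInterlacingPair_one hfg
      obtain ⟨u, hu⟩ := Fintype.exists_ne_of_one_lt_card (by omega : 1 < Fintype.card V) v
      refine ⟨⟨Matrix.of fun a b => if a = b then 0 else if a = v then l else -l,
        IsConstructed.two T v f g _ hn l hl hf hg v u hu.symm ?_ ?_ ?_ ?_⟩, fun A hA => ?_⟩
      · simp [hu.symm]
      · simp [hu]
      · simp
      · simp
      · cases hA with
        | one _ _ _ _ _ hn' => omega
        | two _ _ _ _ _ _ l hl hf hg p q hpq h1 h2 h3 h4 =>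
          exact realizes_of_card_eq_two hn hNEB hfg hl hf hg hpq h1 h2 h3 h4
        | step _ _ _ _ _ hn' => omega
    · have ih' : ∀ (j : V) (h : T.Adj v j) (f g : ℂ[X]),
          IsInterlacingPair (Fintype.card (treeBranch T v j) - 1) f g →
          (∃ B, IsConstructed (T.induce (treeBranch T v j)) ⟨j, mem_treeBranch_self T h⟩ f g B) ∧
          ∀ B, IsConstructed (T.induce (treeBranch T v j)) ⟨j, mem_treeBranch_self T h⟩ f g B →
            Realizes (T.induce (treeBranch T v j)) ⟨j, mem_treeBranch_self T h⟩ f g B := by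
        intro j hj f g hfg
        have h1 := card_treeBranch_pos hj
        have h2 := card_treeBranch_lt (T := T) (v := v) j
        exact ih _ (by omega) _ _ _ _ (by omega) (hNEB.branch hj) hfg
      refine ⟨exists_isConstructed_of_branches hNEB hn hk hfg fun j hj f g h => (ih' j hj f g h).1,
        fun A hA => ?_⟩
      cases hA with
      | one _ _ _ _ _ hn' => omega
      | two _ _ _ _ _ hn' => omega
      | step _ _ _ _ _ hn' gs hs y h1 h2 h3 h4 h5 h6 h7 h8 h9 h10 h11 =>
        have hmem : ∀ {j}, j ∈ T.neighborFinset v ↔ T.Adj v j := T.mem_neighborFinset v _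
        have key := hfg.of_decomposition (N := T.neighborFinset v) (fun j hj => h1 j (hmem.1 hj))
          (fun j hj => by rw [h2 j (hmem.1 hj)]; exact card_treeBranch_pos (hmem.1 hj))
          (fun j hj z hz => (h3 j (hmem.1 hj) z hz).2) h4 (fun j hj => h5 j (hmem.1 hj))
          (fun j hj => h6 j (hmem.1 hj)) h7
        refine realizes_of_branches hT (by omega) hfg (fun j hj => (key j (hmem.2 hj)).1) h4 h7 h8
          (fun j hj => (ih' j hj _ _ ?_).2 _ (h9 j hj)) h10 h11
        rw [← h2 j hj]
        exact (key j (hmem.2 hj)).2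

end Recursion

/-! ### The corollary. -/

theorem corollary3p5 {V : Type u} [Fintype V] (T : SimpleGraph V) (hT : T.IsTree) (v : V)
    (hNEB : IsNEB T v) :
    (∀ (k : ℕ) (_ : 1 ≤ k) (_ : Fintype.card V = k + 1)
        (l : Fin (k + 1) → ℝ) (m : Fin k → ℝ)
        (_ : ∀ j : Fin k, l j.castSucc < m j ∧ m j < l j.succ)
        (_ : ∀ j, l j = -l j.rev) (_ : ∀ j, m j = -m j.rev),
      (∃ A : Matrix V V ℝ,
        IsConstructed T v (∏ j, (X - C (Complex.I * (l j : ℂ))))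
          (∏ j, (X - C (Complex.I * (m j : ℂ)))) A) ∧
      ∀ A : Matrix V V ℝ,
        IsConstructed T v (∏ j, (X - C (Complex.I * (l j : ℂ))))
          (∏ j, (X - C (Complex.I * (m j : ℂ)))) A →
        A ∈ skewMatrices T ∧
        matrixEigs A = Finset.univ.val.map (fun j => Complex.I * (l j : ℂ)) ∧
        (open Classical in matrixEigs (principalSub A ({v}ᶜ : Set V))) =
          Finset.univ.val.map (fun j => Complex.I * (m j : ℂ)) ∧
        HasDuarte A v) ∧
    ∃ A ∈ skewMatrices T, HasDuarte A v := by
  classical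
  constructor
  · intro k _ hn l m hint hl hm
    obtain ⟨h1, h2⟩ := exists_isConstructed_and_forall_realizes k T v _ _ hn hNEB
      ⟨l, m, hint, hl, hm, rfl, rfl⟩
    refine ⟨h1, fun A hA => ?_⟩
    have h := h2 A hA
    refine ⟨⟨h.transpose_eq, h.graph_eq⟩, ?_, ?_, h.hasDuarte⟩
    · rw [matrixEigs_eq_roots_charpoly, h.charpoly_eq, roots_prod_X_sub_C_univ]
    · rw [matrixEigs_eq_roots_charpoly, h.charpoly_sub_eq, roots_prod_X_sub_C_univ]
  · have hpos : 0 < Fintype.card V := Fintype.card_pos_iff.2 ⟨v⟩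
    obtain ⟨k, hn⟩ : ∃ k, Fintype.card V = k + 1 := ⟨Fintype.card V - 1, by omega⟩
    -- For the second claim any symmetric interlacing spectrum will do: the integers from `-k` to
    -- `k` are dealt alternately to the two polynomials. This includes `k = 0`, the tree with one
    -- vertex.
    have hpair : IsInterlacingPair k
        (∏ j : Fin (k + 1), (X - C (Complex.I * ((2 * (j : ℕ) - k : ℝ) : ℂ))))
        (∏ j : Fin k, (X - C (Complex.I * ((2 * (j : ℕ) + 1 - k : ℝ) : ℂ)))) := by
      refine ⟨fun j => 2 * (j : ℕ) - k, fun j => 2 * (j : ℕ) + 1 - k, fun j => ?_, fun j => ?_,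
        fun j => ?_, rfl, rfl⟩
      · simp only [Fin.val_castSucc, Fin.val_succ]
        push_cast
        constructor <;> linarith
      · have : ((j.rev : ℕ) : ℝ) = k - (j : ℕ) := by
          rw [Fin.val_rev, eq_sub_iff_add_eq]
          norm_cast
          omega
        simp only [this]; ring
      · have : ((j.rev : ℕ) : ℝ) = k - 1 - (j : ℕ) := by
          rw [Fin.val_rev, sub_sub, eq_sub_iff_add_eq]
          norm_cast
          omega
        simp only [this]; ring
    obtain ⟨⟨A, hA⟩, h2⟩ := exists_isConstructed_and_forall_realizes k T v _ _ hn hNEB hpair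
    have h := h2 A hA
    exact ⟨A, ⟨h.transpose_eq, h.graph_eq⟩, h.hasDuarte⟩
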